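/- **Definitions.** Let $R$ be a commutative ring, $U$ a subgroup of $R^\times$ and $n \ge 0$. A *$U$-vector* of $R^n$ is a set $[v]=\{cv : c\in U\}$ with $v\in R^n$, $v\neq 0$. A *partial $U$-basis* of $R^n$ is a finite set $\{[v_1],\dots,[v_k]\}$ of $k$ distinct $U$-vectors whose representatives $v_1,\dots,v_k$ form part of a free basis of $R^n$. It is a *determinant-$U$ partial $U$-basis* if, in case $k=n$, moreover $\det(v_1,\dots,v_n)\in U$ for some ordering of the $U$-vectors (when $-1\in U$ the ordering is irrelevant). An *augmented determinant-$U$ partial $U$-basis* is a set $\{[v_0],[v_1],\dots,[v_k]\}$ of $k+1$ distinct $U$-vectors, with $k\ge 2$, such that $\{[v_1],\dots,[v_k]\}$ is a determinant-$U$ partial $U$-basis and $v_0=\lambda v_1+\nu v_2$ for some $\lambda,\nu\in U$. The simplicial complex $\mathrm{BDA}_n^U(R)$ has as simplices all nonempty determinant-$U$ partial $U$-bases and all augmented determinant-$U$ partial $U$-bases of $R^n$. Topological statements about it refer to its geometric realization. A *loop of length 4* is an edge loop through vertices $x_0,x_1,x_2,x_3,x_0$ such that consecutive vertices are joined by an edge.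 **Theorem.** 1. Let $\mathbb F$ be a field and $U$ a subgroup of $\mathbb F^\times$ of index at most $2$ such that - every $c\in\mathbb F^\times\setminus U$ can be written as $c=u_1+u_2$ with $u_1,u_2\in U$; - for every $c\in\mathbb F^\times\setminus U$ there is $u\in U$ with $c+u\in\mathbb F^\times\setminus U$. Then $\mathrm{BDA}_2^U(\mathbb F)$ is simply connected if and only if every loop of length $4$ in it is nullhomotopic. 2. Let $(R,p)$ be one of the pairs $(\mathbb Z[i],3)$, $(\mathbb Z[\omega],4\omega+1)$, $(\mathbb Z[\omega],4\omega+3)$, where $\omega$ is a primitive cube root of unity. Let $\mathbb F=R/(p)$ and let $U$ be the image of $R^\times$ in $\mathbb F^\times$. Then every loop of length $4$ in $\mathrm{BDA}_2^U(\mathbb F)$ is nullhomotopic, and $\mathrm{BDA}_2^U(\mathbb F)$ is $1$-connected, that is, nonempty, path connected and simply connected. -/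

import Mathlib

open scoped unitInterval

noncomputable section

namespace BDAComplex

/-! ### `U`-vectors, determinant-`U` partial `U`-bases, and the complex `BDA` -/

/-- The set of all `c • v` with `c ∈ U`. -/
def unitMultiples {R : Type*} [CommRing R] (U : Subgroup Rˣ) {n : ℕ} (v : Fin n → R) :
    Set (Fin n → R) :=
  {w | ∃ c ∈ U, w = c • v}

/-- A `U`-vector in `R ^ n` is a set of the form `{c • v | c ∈ U}` for a nonzero `v`. A vector
`v` with `v ∈ x.1` is a representative of the `U`-vector `x`. -/
def UVector {R : Type*} [CommRing R] (U : Subgroup Rˣ) (n : ℕ) : Type _ :=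
  {x : Set (Fin n → R) // ∃ v : Fin n → R, v ≠ 0 ∧ x = unitMultiples U v}

/-- A partial `U`-basis of `R ^ n`: a finite set of `U`-vectors that are represented by some of
the members of a free basis of `R ^ n`. -/
def IsPartialUBasis {R : Type*} [CommRing R] {U : Subgroup Rˣ} {n : ℕ}
    (s : Finset (UVector U n)) : Prop :=
  ∃ b : Module.Basis (Fin n) R (Fin n → R), ∀ x ∈ s, ∃ i, b i ∈ x.1

/-- A determinant-`U` partial `U`-basis of `R ^ n`: if it has `n` elements `[v₁], …, [vₙ]`, then
the determinant of the matrix with columns `v₁, …, vₙ` (in some order) has to lie in `U`. As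
distinct `U`-vectors are disjoint, a family `v` of `n` vectors that contains a representative of
each of the `n` elements of `s` consists of exactly one representative of each. -/
def IsDetPartialUBasis {R : Type*} [CommRing R] {U : Subgroup Rˣ} {n : ℕ}
    (s : Finset (UVector U n)) : Prop :=
  IsPartialUBasis s ∧
    (s.card = n → ∃ v : Fin n → Fin n → R, (∀ x ∈ s, ∃ i, v i ∈ x.1) ∧
      ∃ u ∈ U, (Matrix.of v).transpose.det = (u : R))

/-- An augmented determinant-`U` partial `U`-basis: a set `{[v₀], [v₁], …, [vₖ]}` such that
`{[v₁], …, [vₖ]}` is a determinant-`U` partial `U`-basis and `v₀ = lam • v₁ + nu • v₂` for some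
`lam, nu ∈ U`. -/
def IsAugDetPartialUBasis {R : Type*} [CommRing R] {U : Subgroup Rˣ} {n : ℕ}
    (s : Finset (UVector U n)) : Prop :=
  ∃ (t : Finset (UVector U n)) (x₀ : UVector U n) (h : x₀ ∉ t), s = Finset.cons x₀ t h ∧
    IsDetPartialUBasis t ∧
    ∃ x₁ ∈ t, ∃ x₂ ∈ t, x₁ ≠ x₂ ∧
      ∃ v₀ ∈ x₀.1, ∃ v₁ ∈ x₁.1, ∃ v₂ ∈ x₂.1, ∃ lam ∈ U, ∃ nu ∈ U, v₀ = lam • v₁ + nu • v₂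

section Faces

variable {R : Type*} [CommRing R] {U : Subgroup Rˣ} {n : ℕ}

theorem exists_smul_of_mem {x : UVector U n} {v w : Fin n → R} (hv : v ∈ x.1) (hw : w ∈ x.1) :
    ∃ c ∈ U, w = c • v := by
  obtain ⟨x, a, ha, rfl⟩ := x
  obtain ⟨c, hc, rfl⟩ := hv
  obtain ⟨d, hd, rfl⟩ := hw
  exact ⟨d * c⁻¹, U.mul_mem hd (U.inv_mem hc), by rw [smul_smul]; simp⟩

theorem eq_of_mem {x y : UVector U n} {v : Fin n → R} (hx : v ∈ x.1) (hy : v ∈ y.1) : x = y := by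
  have key : ∀ x : UVector U n, v ∈ x.1 → x.1 = unitMultiples U v := by
    rintro ⟨x, a, ha, rfl⟩ ⟨c, hc, rfl⟩
    ext w
    constructor
    · rintro ⟨d, hd, rfl⟩
      exact ⟨d * c⁻¹, U.mul_mem hd (U.inv_mem hc), by rw [smul_smul]; simp⟩
    · rintro ⟨d, hd, rfl⟩
      exact ⟨d * c, U.mul_mem hd hc, by rw [smul_smul]⟩
  exact Subtype.ext ((key x hx).trans (key y hy).symm)

theorem IsPartialUBasis.mono {s t : Finset (UVector U n)} (hs : IsPartialUBasis s) (h : t ⊆ s) :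
    IsPartialUBasis t := by
  obtain ⟨b, hb⟩ := hs
  exact ⟨b, fun x hx => hb x (h hx)⟩

theorem IsPartialUBasis.card_le {s : Finset (UVector U n)} (hs : IsPartialUBasis s) :
    s.card ≤ n := by
  obtain ⟨b, hb⟩ := hs
  choose f hf using hb
  have hinj : Function.Injective fun x : s => f x.1 x.2 := by
    intro x y hxy
    refine Subtype.ext (eq_of_mem (hf x.1 x.2) ?_)
    rw [show f x.1 x.2 = f y.1 y.2 from hxy]
    exact hf y.1 y.2
  simpa using Fintype.card_le_of_injective _ hinj

theorem IsDetPartialUBasis.mono {s t : Finset (UVector U n)} (hs : IsDetPartialUBasis s)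
    (h : t ⊆ s) : IsDetPartialUBasis t := by
  refine ⟨hs.1.mono h, fun ht => ?_⟩
  have : t = s := Finset.eq_of_subset_of_card_le h (by rw [ht]; exact hs.1.card_le)
  subst this
  exact hs.2 ht

/-- Exchange: an element of the additive core may replace `[v₁]`. -/
theorem IsDetPartialUBasis.exchange {t t' : Finset (UVector U n)} (ht : IsDetPartialUBasis t)
    {x₀ x₁ x₂ : UVector U n} (h₁ : x₁ ∈ t) (h₂ : x₂ ∈ t) (hne : x₁ ≠ x₂) (h₁' : x₁ ∉ t')
    (hsub : ∀ x ∈ t', x = x₀ ∨ x ∈ t)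
    {v₀ v₁ v₂ : Fin n → R} (hv₀ : v₀ ∈ x₀.1) (hv₁ : v₁ ∈ x₁.1) (hv₂ : v₂ ∈ x₂.1)
    {lam nu : Rˣ} (hlam : lam ∈ U) (h : v₀ = lam • v₁ + nu • v₂) :
    IsDetPartialUBasis t' := by
  classical
  -- the new family of vectors, with the vector representing `x₁` replaced by `v₀`
  have step : ∀ w : Fin n → Fin n → R, (∀ x ∈ t, ∃ i, w i ∈ x.1) →
      ∃ (i j : Fin n) (a d : Rˣ), i ≠ j ∧ a ∈ U ∧ v₀ = a • w i + d • w j ∧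
        ∀ x ∈ t', ∃ k, Function.update w i v₀ k ∈ x.1 := by
    intro w hw
    obtain ⟨i, hi⟩ := hw x₁ h₁
    obtain ⟨j, hj⟩ := hw x₂ h₂
    have hij : i ≠ j := by
      rintro rfl
      exact hne (eq_of_mem hi hj)
    obtain ⟨c, hc, hc'⟩ := exists_smul_of_mem hi hv₁
    obtain ⟨d, hd, hd'⟩ := exists_smul_of_mem hj hv₂
    refine ⟨i, j, lam * c, nu * d, hij, U.mul_mem hlam hc, ?_, ?_⟩
    · rw [h, hc', hd', smul_smul, smul_smul]
    · intro x hx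
      rcases hsub x hx with rfl | hxt
      · exact ⟨i, by simpa using hv₀⟩
      · obtain ⟨k, hk⟩ := hw x hxt
        have hki : k ≠ i := by
          rintro rfl
          exact h₁' (eq_of_mem hi hk ▸ hx)
        exact ⟨k, by simpa [Function.update_of_ne hki] using hk⟩
  refine ⟨?_, fun hcard => ?_⟩
  · obtain ⟨b, hb⟩ := ht.1
    obtain ⟨i, j, a, d, hij, -, hv, hmem⟩ := step b hb
    have hdet : IsUnit (b.det (Function.update b i v₀)) := by
      have hz : b.det (Function.update b i (b j)) = 0 := by
        apply AlternatingMap.map_eq_zero_of_eq _ _ (i := i) (j := j) _ hij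
        simp [Function.update_of_ne hij.symm]
      rw [hv, Units.smul_def, Units.smul_def, AlternatingMap.map_update_add,
        AlternatingMap.map_update_smul, AlternatingMap.map_update_smul, hz,
        Function.update_eq_self, Module.Basis.det_self]
      simp
    have hbasis := (Module.Basis.is_basis_iff_det b).2 hdet
    refine ⟨Module.Basis.mk hbasis.1 hbasis.2.ge, ?_⟩
    simpa using hmem
  · -- if `t'` has `n` elements then so has `t`
    have hcard' : t.card = n := by
      refine le_antisymm ht.1.card_le ?_
      have hx₀ : t' ⊆ insert x₀ (t.erase x₁) := by
        intro x hx
        rcases hsub x hx with rfl | hxt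
        · simp
        · refine Finset.mem_insert_of_mem (Finset.mem_erase.2 ⟨?_, hxt⟩)
          rintro rfl
          exact h₁' hx
      calc n = t'.card := hcard.symm
        _ ≤ (insert x₀ (t.erase x₁)).card := Finset.card_le_card hx₀
        _ ≤ (t.erase x₁).card + 1 := Finset.card_insert_le _ _
        _ = t.card := Finset.card_erase_add_one h₁
    obtain ⟨w, hw, u, hu, hdet⟩ := ht.2 hcard'
    obtain ⟨i, j, a, d, hij, ha, hv, hmem⟩ := step w hw
    refine ⟨Function.update w i v₀, hmem, a * u, U.mul_mem ha hu, ?_⟩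
    have hupd : Matrix.of (Function.update w i v₀) = (Matrix.of w).updateRow i v₀ := rfl
    have hz : ((Matrix.of w).updateRow i (w j)).det = 0 :=
      Matrix.det_updateRow_eq_zero hij.symm
    have hs : ((Matrix.of w).updateRow i (w i)).det = (Matrix.of w).det := by
      congr 1
      exact Matrix.updateRow_eq_self (Matrix.of w) i
    rw [Matrix.det_transpose] at hdet ⊢
    rw [hupd, hv, Units.smul_def, Units.smul_def, Matrix.det_updateRow_add,
      Matrix.det_updateRow_smul, Matrix.det_updateRow_smul, hz, hs, hdet]
    simp

/-- A nonempty subset of an augmented determinant-`U` partial `U`-basis is again one, or is a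
determinant-`U` partial `U`-basis. -/
theorem IsAugDetPartialUBasis.mono {s t' : Finset (UVector U n)} (hs : IsAugDetPartialUBasis s)
    (hsub : t' ⊆ s) : IsDetPartialUBasis t' ∨ IsAugDetPartialUBasis t' := by
  classical
  obtain ⟨t, x₀, hx₀, rfl, ht, x₁, h₁, x₂, h₂, hne, v₀, hv₀, v₁, hv₁, v₂, hv₂, lam, hlam, nu,
    hnu, h⟩ := hs
  have hsub' : ∀ x ∈ t', x = x₀ ∨ x ∈ t := fun x hx => Finset.mem_cons.1 (hsub hx)
  by_cases h0 : x₀ ∈ t'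
  · by_cases h1 : x₁ ∈ t'
    · by_cases h2 : x₂ ∈ t'
      · right
        have hsubset : t'.erase x₀ ⊆ t := fun x hx =>
          (hsub' x (Finset.mem_of_mem_erase hx)).resolve_left (Finset.ne_of_mem_erase hx)
        refine ⟨t'.erase x₀, x₀, Finset.notMem_erase _ _, ?_, ht.mono hsubset, x₁, ?_, x₂, ?_,
          hne, v₀, hv₀, v₁, hv₁, v₂, hv₂, lam, hlam, nu, hnu, h⟩
        · rw [Finset.cons_eq_insert, Finset.insert_erase h0]
        · exact Finset.mem_erase.2 ⟨fun e => hx₀ (e ▸ h₁), h1⟩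
        · exact Finset.mem_erase.2 ⟨fun e => hx₀ (e ▸ h₂), h2⟩
      · left
        exact ht.exchange h₂ h₁ hne.symm h2 hsub' hv₀ hv₂ hv₁ hnu
          (by rw [h]; exact add_comm _ _)
    · left
      exact ht.exchange h₁ h₂ hne h1 hsub' hv₀ hv₁ hv₂ hlam h
  · left
    refine ht.mono fun x hx => (hsub' x hx).resolve_left ?_
    rintro rfl
    exact h0 hx

end Faces

/-- The complex `BDA_n^U(R)` of augmented determinant-`U` partial `U`-bases of `R ^ n`. -/
def BDA {R : Type*} [CommRing R] (U : Subgroup Rˣ) (n : ℕ) :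
    PreAbstractSimplicialComplex (UVector U n) where
  faces := {s | s.Nonempty ∧ (IsDetPartialUBasis s ∨ IsAugDetPartialUBasis s)}
  isRelLowerSet_faces := by
    rintro s ⟨hne, hs⟩
    refine ⟨hne, fun t hts ht => ⟨ht, ?_⟩⟩
    rcases hs with hs | hs
    · exact Or.inl (hs.mono hts)
    · exact hs.mono hts

/-! ### Geometric realization -/

variable {V : Type*}

/-- The points of the geometric realization of a simplicial complex `K`: functions on the vertices
(barycentric coordinates) that are nonnegative, vanish outside some face, and sum to `1`. -/
def Realization (K : PreAbstractSimplicialComplex V) : Type _ :=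
  {p : V → ℝ // (∀ v, 0 ≤ p v) ∧ ∃ s ∈ K.faces, (∀ v, v ∉ s → p v = 0) ∧ ∑ v ∈ s, p v = 1}

/-- The inclusion of the closed simplex spanned by a face `s` into the geometric realization. -/
def simplexMap (K : PreAbstractSimplicialComplex V) (s : K.faces)
    (x : stdSimplex ℝ (s : Finset V)) : Realization K :=
  ⟨Function.extend Subtype.val x.1 0, by
    have hval : ∀ v : (s : Finset V), Function.extend Subtype.val x.1 0 v.1 = x.1 v :=
      fun v => Subtype.val_injective.extend_apply _ _ _
    have hout : ∀ v, v ∉ (s : Finset V) → Function.extend Subtype.val x.1 (0 : V → ℝ) v = 0 := by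
      intro v hv
      rw [Function.extend_apply']
      · rfl
      · rintro ⟨w, rfl⟩
        exact hv w.2
    refine ⟨fun v => ?_, s.1, s.2, hout, ?_⟩
    · by_cases hv : v ∈ (s : Finset V)
      · rw [hval ⟨v, hv⟩]
        exact x.2.1 _
      · rw [hout v hv]
    · rw [← Finset.sum_coe_sort]
      simp only [hval]
      exact x.2.2⟩

/-- The weak (coherent) topology: a set is open iff its intersection with each closed simplex is
open in that simplex. -/
instance (K : PreAbstractSimplicialComplex V) : TopologicalSpace (Realization K) :=
  ⨆ s : K.faces, TopologicalSpace.coinduced (simplexMap K s) inferInstance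

/-- Two vertices are joined by an edge of `K`. -/
def Edge (K : PreAbstractSimplicialComplex V) (v w : V) : Prop :=
  v ≠ w ∧ ∃ s ∈ K.faces, v ∈ s ∧ w ∈ s

theorem Edge.symm {K : PreAbstractSimplicialComplex V} {v w : V} (h : Edge K v w) :
    Edge K w v :=
  ⟨h.1.symm, h.2.imp fun _ hs => ⟨hs.1, hs.2.2, hs.2.1⟩⟩

open Classical in
/-- A vertex of `K`, as a point of the geometric realization. -/
def vertexPoint (K : PreAbstractSimplicialComplex V) (v : V) (hv : ∃ s ∈ K.faces, v ∈ s) :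
    Realization K :=
  ⟨Pi.single v 1, fun w => by
      by_cases h : w = v
      · subst h; simp
      · simp [h], by
    obtain ⟨s, hs, hvs⟩ := hv
    refine ⟨s, hs, fun w hw => Pi.single_eq_of_ne (fun h => hw (by rw [h]; exact hvs)) _, ?_⟩
    simp [hvs]⟩

theorem Edge.left {K : PreAbstractSimplicialComplex V} {v w : V} (h : Edge K v w) :
    ∃ s ∈ K.faces, v ∈ s :=
  h.2.imp fun _ hs => ⟨hs.1, hs.2.1⟩

open Classical in
/-- The point `(1 - t) v + t w` of the simplex spanned by a finite set containing `v` and `w`. -/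
def segmentPoint {s : Finset V} {v w : V} (hv : v ∈ s) (hw : w ∈ s) (t : I) :
    stdSimplex ℝ s :=
  ⟨(1 - (t : ℝ)) • Pi.single ⟨v, hv⟩ 1 + (t : ℝ) • Pi.single ⟨w, hw⟩ 1,
    (convex_stdSimplex ℝ s) (single_mem_stdSimplex ℝ _) (single_mem_stdSimplex ℝ _)
      (by have := t.2.2; linarith) t.2.1 (by ring)⟩

theorem simplexMap_segmentPoint_apply {K : PreAbstractSimplicialComplex V} (s : K.faces) {v w : V}
    (hv : v ∈ (s : Finset V)) (hw : w ∈ (s : Finset V)) (t : I) [DecidableEq V] :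
    (simplexMap K s (segmentPoint hv hw t)).1 =
      (1 - (t : ℝ)) • Pi.single v 1 + (t : ℝ) • Pi.single w 1 := by
  classical
  funext x
  by_cases hx : x ∈ (s : Finset V)
  · have : (simplexMap K s (segmentPoint hv hw t)).1 x = (segmentPoint hv hw t).1 ⟨x, hx⟩ :=
      Subtype.val_injective.extend_apply _ _ (⟨x, hx⟩ : (s : Finset V))
    rw [this]
    simp [segmentPoint, Pi.single_apply]
  · have : (simplexMap K s (segmentPoint hv hw t)).1 x = 0 := by
      refine Function.extend_apply' _ _ _ ?_
      rintro ⟨y, rfl⟩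
      exact hx y.2
    rw [this]
    have h1 : x ≠ v := fun h => hx (h ▸ hv)
    have h2 : x ≠ w := fun h => hx (h ▸ hw)
    simp [h1, h2]

theorem continuous_simplexMap (K : PreAbstractSimplicialComplex V) (s : K.faces) :
    Continuous (simplexMap K s) :=
  continuous_iff_coinduced_le.2
    (le_iSup (fun s : K.faces => TopologicalSpace.coinduced (simplexMap K s) inferInstance) s)

open Classical in
/-- The straight path `t ↦ (1 - t) v + t w` along an edge, in the geometric realization. -/
def edgePath {K : PreAbstractSimplicialComplex V} {v w : V} (h : Edge K v w) :
    Path (vertexPoint K v h.left) (vertexPoint K w h.symm.left) where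
  toFun t := ⟨(1 - (t : ℝ)) • Pi.single v 1 + (t : ℝ) • Pi.single w 1, by
    obtain ⟨s, hs, hv, hw⟩ := h.2
    rw [← simplexMap_segmentPoint_apply ⟨s, hs⟩ hv hw t]
    exact (simplexMap K ⟨s, hs⟩ (segmentPoint hv hw t)).2⟩
  continuous_toFun := by
    obtain ⟨s, hs, hv, hw⟩ := h.2
    have hc : Continuous fun t : I => simplexMap K ⟨s, hs⟩ (segmentPoint hv hw t) := by
      refine (continuous_simplexMap K ⟨s, hs⟩).comp (Continuous.subtype_mk ?_ _)
      fun_prop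
    refine hc.congr fun t => Subtype.ext ?_
    exact simplexMap_segmentPoint_apply ⟨s, hs⟩ hv hw t
  source' := Subtype.ext (by simp [vertexPoint])
  target' := Subtype.ext (by simp [vertexPoint])

/-- All loops of length 4 in `K` are nullhomotopic in the geometric realization: whenever
`v₀, v₁, v₂, v₃, v₀` are consecutively joined by edges, the loop that runs through these four
edges is homotopic, relative to its base point, to the constant loop. -/
def FourLoopsNullhomotopic (K : PreAbstractSimplicialComplex V) : Prop :=
  ∀ (v₀ v₁ v₂ v₃ : V) (h₀₁ : Edge K v₀ v₁) (h₁₂ : Edge K v₁ v₂) (h₂₃ : Edge K v₂ v₃)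
    (h₃₀ : Edge K v₃ v₀),
    Path.Homotopic ((((edgePath h₀₁).trans (edgePath h₁₂)).trans (edgePath h₂₃)).trans
      (edgePath h₃₀)) (Path.refl _)

/-! ### The three quotients -/

/-- The image in the units of `R ⧸ (p)` of the group of units of `R`. -/
def unitImage {R : Type*} [CommRing R] (p : R) : Subgroup (R ⧸ Ideal.span {p})ˣ :=
  (Units.map (Ideal.Quotient.mk (Ideal.span {p})).toMonoidHom).range

/-- The Eisenstein integers `ℤ[ω]`, where `ω ^ 2 = -1 - ω`. -/
abbrev EisensteinInt : Type := QuadraticAlgebra ℤ (-1) (-1)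

/-- The primitive cube root of unity `ω` in the Eisenstein integers. -/
def eisensteinOmega : EisensteinInt := ⟨0, 1⟩

end BDAComplex

end

open scoped unitInterval

noncomputable section

namespace BDAComplex

/-! ### The weak topology on the geometric realization -/

section Topology

variable {V : Type*} {K : PreAbstractSimplicialComplex V}

/-! A loop of length four is a loop, so one direction of the first part is immediate. For the
converse, simple connectivity is reduced to a combinatorial statement: choose for every vertex a
path class from a base vertex `x₀` so that the choices are compatible with every edge (`IsCone`).
Such a choice extends to all points, because open stars contract along straight segments and every
path can be cut into pieces lying in open stars. The class of any path is then determined by its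
endpoints (`IsCone.simplyConnectedSpace`).

The choice uses edge paths of length at most two. Two of these with the same endpoints are
homotopic: they close up to a loop of length at most four, and triangles reduce to quadrilaterals
because every edge lies in a filled triangle. Compatibility along an edge could fail only for
pentagons through `x₀`, and these are filled by a common neighbour of three vertices
(`exists_pentagon_center`). If `-1 ∈ U`, vertices at distance more than two are the multiples `c •
x` of the base vector `x` with `c ∉ U`. All their neighbours are within distance two, and any two
distinct neighbours are connected by a detour through another such vertex (`exists_near_bypass`). If
`-1 ∉ U`, then `U ∪ -U` is everything, adjacency is linear independence, and neither problem arises.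

For the three quotients, the common neighbours of non-adjacent independent `x` and `z` are the
classes of `x + b • z` up to a common scalar, `b ∈ U`. Those for `b` and `g * b` are adjacent as
soon as `1 - g` is nonzero and not in `U`. If `U` is generated by such `g`, all paths `x, y, z` are
homotopic (`fourLoopsNullhomotopic_of_closure`). Suitable generators are `i` modulo 3, and `-1, ω`
modulo a prime of norm 13. -/

theorem simplexMap_apply (s : K.faces) (x : stdSimplex ℝ (s : Finset V)) {v : V}
    (hv : v ∈ (s : Finset V)) : (simplexMap K s x).1 v = x.1 ⟨v, hv⟩ :=
  Subtype.val_injective.extend_apply _ _ (⟨v, hv⟩ : (s : Finset V))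

theorem simplexMap_apply_of_notMem (s : K.faces) (x : stdSimplex ℝ (s : Finset V)) {v : V}
    (hv : v ∉ (s : Finset V)) : (simplexMap K s x).1 v = 0 := by
  refine Function.extend_apply' _ _ _ ?_
  rintro ⟨y, rfl⟩
  exact hv y.2

theorem isOpen_realization_iff {O : Set (Realization K)} :
    IsOpen O ↔ ∀ s : K.faces, IsOpen (simplexMap K s ⁻¹' O) := by
  simp only [isOpen_iSup_iff, isOpen_coinduced]

theorem continuousOn_realization_iff {Z : Type*} [TopologicalSpace Z] {f : Realization K → Z}
    {U : Set (Realization K)} (hU : IsOpen U) :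
    ContinuousOn f U ↔
      ∀ s : K.faces, ContinuousOn (f ∘ simplexMap K s) (simplexMap K s ⁻¹' U) := by
  constructor
  · intro h s
    exact h.comp (continuous_simplexMap K s).continuousOn fun _ hx => hx
  · intro h
    refine (continuousOn_open_iff hU).2 fun O hO => isOpen_realization_iff.2 fun s => ?_
    exact (continuousOn_open_iff (hU.preimage (continuous_simplexMap K s))).1 (h s) O hO

/-- The open star of a vertex: the points with positive coordinate at it. -/
def openStar (K : PreAbstractSimplicialComplex V) (v : V) : Set (Realization K) :=
  {p | 0 < p.1 v}

theorem isOpen_openStar (v : V) : IsOpen (openStar K v) := by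
  refine isOpen_realization_iff.2 fun s => ?_
  by_cases hv : v ∈ (s : Finset V)
  · have : simplexMap K s ⁻¹' openStar K v = {x | 0 < x.1 ⟨v, hv⟩} := by
      ext x
      simp [openStar, simplexMap_apply s x hv]
    rw [this]
    exact isOpen_lt continuous_const ((continuous_apply _).comp continuous_subtype_val)
  · convert! isOpen_empty
    ext x
    simp [openStar, simplexMap_apply_of_notMem s x hv]

/-- The point `p` lies in the closed simplex spanned by `s`. -/
def SupportedIn (p : Realization K) (s : Finset V) : Prop :=
  ∀ v, v ∉ s → p.1 v = 0

theorem SupportedIn.exists_simplexMap_eq {p : Realization K} {s : K.faces}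
    (hp : SupportedIn p (s : Finset V)) : ∃ x, simplexMap K s x = p := by
  classical
  refine ⟨⟨fun v => p.1 v, fun v => p.2.1 v, ?_⟩, Subtype.ext (funext fun v => ?_)⟩
  · obtain ⟨-, s', -, h0, h1⟩ := p.2
    rw [Finset.sum_coe_sort (s : Finset V) p.1]
    refine Eq.trans ?_ h1
    calc ∑ v ∈ (s : Finset V), p.1 v = ∑ v ∈ (s : Finset V) ∪ s', p.1 v :=
          Finset.sum_subset Finset.subset_union_left fun v _ hv => hp v hv
      _ = _ := (Finset.sum_subset Finset.subset_union_right fun v _ hv => h0 v hv).symm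
  · by_cases hv : v ∈ (s : Finset V)
    · rw [simplexMap_apply s _ hv]
    · rw [simplexMap_apply_of_notMem s _ hv, hp v hv]

theorem exists_supportedIn (p : Realization K) :
    ∃ s : K.faces, SupportedIn p (s : Finset V) := by
  obtain ⟨-, s, hs, h0, -⟩ := p.2
  exact ⟨⟨s, hs⟩, h0⟩

theorem SupportedIn.mem_of_mem_openStar {p : Realization K} {s : Finset V} (hp : SupportedIn p s)
    {v : V} (hv : p ∈ openStar K v) : v ∈ s := by
  by_contra h
  exact (ne_of_gt hv) (hp v h)

theorem exists_mem_openStar (p : Realization K) : ∃ v, p ∈ openStar K v := by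
  obtain ⟨h0, s, -, -, h1⟩ := p.2
  obtain ⟨v, -, hv⟩ : ∃ v ∈ s, p.1 v ≠ 0 := by
    by_contra! h
    rw [Finset.sum_eq_zero h] at h1
    exact zero_ne_one h1
  exact ⟨v, lt_of_le_of_ne (h0 v) hv.symm⟩

theorem supportedIn_vertexPoint {v : V} (hv : ∃ s ∈ K.faces, v ∈ s) {s : Finset V} (h : v ∈ s) :
    SupportedIn (vertexPoint K v hv) s := by
  intro w hw
  have : w ≠ v := fun e => hw (e ▸ h)
  simp [vertexPoint, this]

/-! ### Straight paths -/

/-- Convex combination of two points of a standard simplex. -/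
def stdSegment {ι : Type*} [Fintype ι] (x y : stdSimplex ℝ ι) (t : I) : stdSimplex ℝ ι :=
  ⟨(1 - (t : ℝ)) • x.1 + (t : ℝ) • y.1, (convex_stdSimplex ℝ ι) x.2 y.2
    (by have := t.2.2; linarith) t.2.1 (by ring)⟩

theorem simplexMap_stdSegment (s : K.faces) (x y : stdSimplex ℝ (s : Finset V)) (t : I) :
    (simplexMap K s (stdSegment x y t)).1 =
      (1 - (t : ℝ)) • (simplexMap K s x).1 + (t : ℝ) • (simplexMap K s y).1 := by
  funext v
  by_cases hv : v ∈ (s : Finset V)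
  · simp [simplexMap_apply s _ hv, stdSegment]
  · simp [simplexMap_apply_of_notMem s _ hv]

/-- A path that runs along a straight segment with constant speed. -/
def IsStraight {a b : Realization K} (γ : Path a b) : Prop :=
  ∀ t, (γ t).1 = (1 - (t : ℝ)) • a.1 + (t : ℝ) • b.1

/-- The straight path between two points of a standard simplex. -/
def stdSegmentPath {ι : Type*} [Fintype ι] (x y : stdSimplex ℝ ι) : Path x y where
  toFun := stdSegment x y
  continuous_toFun := by
    refine Continuous.subtype_mk ?_ _
    fun_prop
  source' := Subtype.ext (by simp [stdSegment])
  target' := Subtype.ext (by simp [stdSegment])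

theorem exists_isStraight {a b : Realization K} {s : K.faces} (ha : SupportedIn a (s : Finset V))
    (hb : SupportedIn b (s : Finset V)) : ∃ γ : Path a b, IsStraight γ := by
  obtain ⟨x, rfl⟩ := ha.exists_simplexMap_eq
  obtain ⟨y, rfl⟩ := hb.exists_simplexMap_eq
  exact ⟨(stdSegmentPath x y).map (continuous_simplexMap K s),
    fun t => simplexMap_stdSegment s x y t⟩

theorem isStraight_edgePath {v w : V} (h : Edge K v w) : IsStraight (edgePath h) :=
  fun _ => rfl

/-- All homotopies are produced by pushing forward from a simply connected model, either a simplex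
or a square, where any two paths with the same endpoints are homotopic. -/
theorem homotopic_of_lift {X Y : Type*} [TopologicalSpace X] [TopologicalSpace Y]
    [SimplyConnectedSpace Y] {f : Y → X} (hf : Continuous f) {a b c : X} {p : Path a b}
    {q : Path b c} {r : Path a c} {A B C : Y} (P : Path A B) (Q : Path B C) (R : Path A C)
    (hp : ∀ t, f (P t) = p t) (hq : ∀ t, f (Q t) = q t) (hr : ∀ t, f (R t) = r t) :
    (p.trans q).Homotopic r := by
  obtain rfl : f A = a := by simpa using hp 0
  obtain rfl : f B = b := by simpa using hp 1
  obtain rfl : f C = c := by simpa using hq 1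
  obtain rfl : P.map hf = p := Path.ext (funext hp)
  obtain rfl : Q.map hf = q := Path.ext (funext hq)
  obtain rfl : R.map hf = r := Path.ext (funext hr)
  rw [← Path.map_trans]
  exact (SimplyConnectedSpace.paths_homotopic (P.trans Q) R).map ⟨f, hf⟩

theorem IsStraight.trans_homotopic {a b c : Realization K} {s : K.faces}
    (ha : SupportedIn a (s : Finset V)) (hb : SupportedIn b (s : Finset V))
    (hc : SupportedIn c (s : Finset V)) {p : Path a b} {q : Path b c} {r : Path a c}
    (hp : IsStraight p) (hq : IsStraight q) (hr : IsStraight r) : (p.trans q).Homotopic r := by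
  obtain ⟨x, rfl⟩ := ha.exists_simplexMap_eq
  obtain ⟨y, rfl⟩ := hb.exists_simplexMap_eq
  obtain ⟨z, rfl⟩ := hc.exists_simplexMap_eq
  have : ContractibleSpace (stdSimplex ℝ (s : Finset V)) :=
    (convex_stdSimplex ℝ _).contractibleSpace ⟨x.1, x.2⟩
  refine homotopic_of_lift (continuous_simplexMap K s) (stdSegmentPath x y) (stdSegmentPath y z)
    (stdSegmentPath x z) ?_ ?_ ?_
  · exact fun t => Subtype.ext ((simplexMap_stdSegment s x y t).trans (hp t).symm)
  · exact fun t => Subtype.ext ((simplexMap_stdSegment s y z t).trans (hq t).symm)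
  · exact fun t => Subtype.ext ((simplexMap_stdSegment s x z t).trans (hr t).symm)

/-! ### Contracting an open star -/

open Classical in
/-- The segment from `p` to the vertex `v` as a function of `p`, constant off the open star. -/
def starSegment {v : V} (hv : ∃ s ∈ K.faces, v ∈ s) (p : Realization K) : C(I, Realization K) :=
  if h : p ∈ openStar K v then
    (exists_isStraight (exists_supportedIn p).choose_spec (supportedIn_vertexPoint hv
      ((exists_supportedIn p).choose_spec.mem_of_mem_openStar h))).choose.toContinuousMap
  else ContinuousMap.const I p

theorem starSegment_apply {v : V} (hv : ∃ s ∈ K.faces, v ∈ s) {p : Realization K}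
    (h : p ∈ openStar K v) (t : I) :
    (starSegment hv p t).1 = (1 - (t : ℝ)) • p.1 + (t : ℝ) • (vertexPoint K v hv).1 := by
  rw [starSegment, dif_pos h]
  exact (exists_isStraight (exists_supportedIn p).choose_spec (supportedIn_vertexPoint hv
      ((exists_supportedIn p).choose_spec.mem_of_mem_openStar h))).choose_spec t

/-- Products interact badly with the weak topology, so joint continuity of the contraction is not
checked directly. As a map into the space of paths it can be tested on each closed simplex, where it
is the currying of an affine formula. Local compactness of `I` allows uncurrying afterwards. -/
theorem continuousOn_starSegment {v : V} (hv : ∃ s ∈ K.faces, v ∈ s) :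
    ContinuousOn (starSegment hv) (openStar K v) := by
  refine (continuousOn_realization_iff (isOpen_openStar v)).2 fun s => ?_
  by_cases hvs : v ∈ (s : Finset V)
  · obtain ⟨y, hy⟩ := (supportedIn_vertexPoint (K := K) hv hvs).exists_simplexMap_eq
    let g : C(stdSimplex ℝ (s : Finset V) × I, Realization K) :=
      ⟨fun z => simplexMap K s (stdSegment z.1 y z.2),
        (continuous_simplexMap K s).comp (Continuous.subtype_mk (by fun_prop) _)⟩
    refine g.curry.continuous.continuousOn.congr fun x hx => ?_
    refine ContinuousMap.ext fun t => Subtype.ext ?_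
    rw [Function.comp_apply, starSegment_apply hv hx, ContinuousMap.curry_apply]
    exact ((simplexMap_stdSegment s x y t).trans (by rw [hy])).symm
  · convert! continuousOn_empty _
    ext x
    simp [openStar, simplexMap_apply_of_notMem s x hvs]

/-- The segments from the points of `γ` to `v` form a square whose sides are `γ`, `q`, `p` and a
constant path. Both ways around it are homotopic to the diagonal `r`. -/
theorem trans_homotopic_of_mem_openStar {v : V} (hv : ∃ s ∈ K.faces, v ∈ s) {a b : Realization K}
    {γ : Path a b} (hγ : ∀ t, γ t ∈ openStar K v) {p : Path a (vertexPoint K v hv)}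
    {q : Path b (vertexPoint K v hv)} (hp : IsStraight p) (hq : IsStraight q) :
    (γ.trans q).Homotopic p := by
  let f : C(I, C(I, Realization K)) := ⟨fun t => starSegment hv (γ t),
    (continuousOn_starSegment hv).comp_continuous γ.continuous hγ⟩
  have hf : Continuous fun z : I × I => f z.1 z.2 :=
    ContinuousMap.continuous_uncurry_of_continuous f
  have hfv : ∀ t r, (f t r).1 = (1 - (r : ℝ)) • (γ t).1 + (r : ℝ) • (vertexPoint K v hv).1 :=
    fun t r => starSegment_apply hv (hγ t) r
  let P : Path ((0 : I), (0 : I)) (1, 0) := ⟨⟨fun t => (t, 0), by fun_prop⟩, rfl, rfl⟩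
  let Q : Path ((1 : I), (0 : I)) (1, 1) := ⟨⟨fun t => (1, t), by fun_prop⟩, rfl, rfl⟩
  let R : Path ((0 : I), (0 : I)) (1, 1) := ⟨⟨fun t => (t, t), by fun_prop⟩, rfl, rfl⟩
  have : ContractibleSpace I := (convex_Icc (0 : ℝ) 1).contractibleSpace ⟨0, by simp⟩
  let R' : Path ((0 : I), (0 : I)) (0, 1) := ⟨⟨fun t => (0, t), by fun_prop⟩, rfl, rfl⟩
  let S : Path ((0 : I), (1 : I)) (1, 1) := ⟨⟨fun t => (t, 1), by fun_prop⟩, rfl, rfl⟩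
  let r : Path a (vertexPoint K v hv) := (R.map hf).cast
    (Subtype.ext (by simp [hfv])) (Subtype.ext (by simp [hfv]))
  have h1 : (γ.trans q).Homotopic r := by
    refine homotopic_of_lift hf P Q R ?_ ?_ ?_
    · exact fun t => Subtype.ext (by simp [P, hfv])
    · exact fun t => Subtype.ext (by simp [Q, hfv, hq t])
    · exact fun t => rfl
  have h2 : (p.trans (Path.refl _)).Homotopic r := by
    refine homotopic_of_lift hf R' S R ?_ ?_ ?_
    · exact fun t => Subtype.ext (by simp [R', hfv, hp t])
    · exact fun t => Subtype.ext (by simp [S, hfv])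
    · exact fun t => rfl
  exact h1.trans (h2.symm.trans ⟨Path.Homotopy.transRefl p⟩)

end Topology

/-! ### Simple connectivity from compatible path classes at the vertices -/

section Cone

open Path.Homotopic

variable {V : Type*} {K : PreAbstractSimplicialComplex V}

/-- A choice of path classes from `x₀` to all vertices, compatible with all edges. -/
def IsCone (hK : ∀ v, ∃ s ∈ K.faces, v ∈ s) (x₀ : V)
    (c : ∀ v, Path.Homotopic.Quotient (vertexPoint K x₀ (hK x₀)) (vertexPoint K v (hK v))) : Prop :=
  ∀ v w (h : Edge K v w), (c v).trans (.mk (edgePath h)) = c w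

theorem exists_straightSegment {v : V} (hv : ∃ s ∈ K.faces, v ∈ s) {p : Realization K}
    (h : p ∈ openStar K v) : ∃ γ : Path p (vertexPoint K v hv), IsStraight γ :=
  exists_isStraight (exists_supportedIn p).choose_spec (supportedIn_vertexPoint hv
    ((exists_supportedIn p).choose_spec.mem_of_mem_openStar h))

variable {hK : ∀ v, ∃ s ∈ K.faces, v ∈ s} {x₀ : V}
  {c : ∀ v, Path.Homotopic.Quotient (vertexPoint K x₀ (hK x₀)) (vertexPoint K v (hK v))}

/-- A point in the open stars of `v` and `w` lies in a closed simplex containing both, so the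
triangle on the point, `v` and `w` is filled, and the cone condition on the edge `v w` absorbs the
difference. Hence `coneClass` does not depend on the chosen vertex. -/
theorem IsCone.symm_eq (hc : IsCone hK x₀ c) {p : Realization K} {v w : V}
    (hv : p ∈ openStar K v) (hw : p ∈ openStar K w) {γ : Path p (vertexPoint K v (hK v))}
    {δ : Path p (vertexPoint K w (hK w))} (hγ : IsStraight γ) (hδ : IsStraight δ) :
    (c v).trans (Path.Homotopic.Quotient.mk γ).symm =
      (c w).trans (Path.Homotopic.Quotient.mk δ).symm := by
  by_cases hvw : v = w
  · subst hvw
    have : γ = δ := Path.ext (funext fun t => Subtype.ext ((hγ t).trans (hδ t).symm))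
    rw [this]
  · obtain ⟨s, hs⟩ := exists_supportedIn p
    have hvs := hs.mem_of_mem_openStar hv
    have hws := hs.mem_of_mem_openStar hw
    have he : Edge K v w := ⟨hvw, s.1, s.2, hvs, hws⟩
    have := IsStraight.trans_homotopic hs (supportedIn_vertexPoint (hK v) hvs)
      (supportedIn_vertexPoint (hK w) hws) hγ (isStraight_edgePath he) hδ
    rw [← Path.Homotopic.Quotient.eq, Path.Homotopic.Quotient.mk_trans] at this
    have h2 := hc v w he
    rw [← this, ← h2]
    generalize Path.Homotopic.Quotient.mk γ = g
    generalize Path.Homotopic.Quotient.mk (edgePath he) = e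
    have : (g.trans e).symm = e.symm.trans g.symm := by
      calc (g.trans e).symm = (g.trans e).symm.trans (g.trans (e.trans (e.symm.trans g.symm))) := by
            rw [← Path.Homotopic.Quotient.trans_assoc e]; simp
        _ = ((g.trans e).symm.trans (g.trans e)).trans (e.symm.trans g.symm) := by
            simp only [Path.Homotopic.Quotient.trans_assoc]
        _ = _ := by simp
    rw [this, Path.Homotopic.Quotient.trans_assoc, ← Path.Homotopic.Quotient.trans_assoc e]
    simp

/-- The class of paths to an arbitrary point determined by a cone. -/
def coneClass (hK : ∀ v, ∃ s ∈ K.faces, v ∈ s)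
    (c : ∀ v, Path.Homotopic.Quotient (vertexPoint K x₀ (hK x₀)) (vertexPoint K v (hK v)))
    (p : Realization K) : Path.Homotopic.Quotient (vertexPoint K x₀ (hK x₀)) p :=
  (c (exists_mem_openStar p).choose).trans (Path.Homotopic.Quotient.mk
    (exists_straightSegment (hK _) (exists_mem_openStar p).choose_spec).choose).symm

theorem IsCone.coneClass_eq (hc : IsCone hK x₀ c) {p : Realization K} {v : V}
    (hv : p ∈ openStar K v) {γ : Path p (vertexPoint K v (hK v))} (hγ : IsStraight γ) :
    coneClass hK c p = (c v).trans (Path.Homotopic.Quotient.mk γ).symm :=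
  hc.symm_eq (exists_mem_openStar p).choose_spec hv
    (exists_straightSegment (hK _) (exists_mem_openStar p).choose_spec).choose_spec hγ

theorem IsCone.coneClass_trans_of_mem_openStar (hc : IsCone hK x₀ c) {a b : Realization K} {v : V}
    {γ : Path a b} (hγ : ∀ t, γ t ∈ openStar K v) :
    (coneClass hK c a).trans (.mk γ) = coneClass hK c b := by
  have ha : a ∈ openStar K v := by simpa using hγ 0
  have hb : b ∈ openStar K v := by simpa using hγ 1
  obtain ⟨p, hp⟩ := exists_straightSegment (hK v) ha
  obtain ⟨q, hq⟩ := exists_straightSegment (hK v) hb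
  rw [hc.coneClass_eq ha hp, hc.coneClass_eq hb hq]
  have := trans_homotopic_of_mem_openStar (hK v) hγ hp hq
  rw [← Path.Homotopic.Quotient.eq, Path.Homotopic.Quotient.mk_trans] at this
  rw [← this]
  generalize Path.Homotopic.Quotient.mk γ = g
  generalize Path.Homotopic.Quotient.mk q = e
  calc ((c v).trans (g.trans e).symm).trans g
      = ((c v).trans (g.trans e).symm).trans (g.trans (e.trans e.symm)) := by simp
    _ = (c v).trans (((g.trans e).symm.trans (g.trans e)).trans e.symm) := by
      simp only [Path.Homotopic.Quotient.trans_assoc]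
    _ = _ := by simp

/-- The open stars cover the realization, so a Lebesgue subdivision of `I` cuts `γ` into pieces each
inside one star, where the claim is already known. -/
theorem IsCone.coneClass_trans (hc : IsCone hK x₀ c) {a b : Realization K} (γ : Path a b) :
    (coneClass hK c a).trans (.mk γ) = coneClass hK c b := by
  obtain ⟨t, ht0, hmono, ⟨n, hn⟩, hcover⟩ := exists_monotone_Icc_subset_open_cover_unitInterval
    (c := fun v => γ ⁻¹' openStar K v) (fun v => (isOpen_openStar v).preimage γ.continuous)
    (fun s _ => Set.mem_iUnion.2 (exists_mem_openStar (γ s)))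
  have key : ∀ n, (coneClass hK c (γ (t 0))).trans (.mk (γ.subpath (t 0) (t n))) =
      coneClass hK c (γ (t n)) := by
    intro n
    induction n with
    | zero => simp
    | succ n ih =>
      obtain ⟨v, hv⟩ := hcover n
      have h1 : ∀ s, γ.subpath (t n) (t (n + 1)) s ∈ openStar K v := by
        intro s
        have := Set.mem_range_self (f := γ.subpath (t n) (t (n + 1))) s
        rw [Path.range_subpath_of_le _ _ _ (hmono n.le_succ)] at this
        obtain ⟨r, hr, hrs⟩ := this
        rw [← hrs]
        exact hv hr
      rw [← hc.coneClass_trans_of_mem_openStar h1, ← ih, Path.Homotopic.Quotient.trans_assoc,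
        ← Path.Homotopic.Quotient.mk_trans,
        Path.Homotopic.Quotient.eq.2 ⟨Path.Homotopy.subpathTransSubpath γ _ _ _⟩]
  have := key n
  rw [ht0, hn n le_rfl] at this
  rw [Path.subpath_zero_one, Path.Homotopic.Quotient.mk_cast] at this
  -- The subdivision speaks of `γ 0` and `γ 1`, which agree with `a` and `b` only propositionally;
  -- this transports the identity.
  have hcast : ∀ {a' b'} (ha : a' = a) (hb : b' = b) (g : Path.Homotopic.Quotient a b),
      (coneClass hK c a').trans (g.cast ha hb) = coneClass hK c b' →
        (coneClass hK c a).trans g = coneClass hK c b := by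
    rintro _ _ rfl rfl g hg
    simpa using hg
  exact hcast γ.source γ.target _ this

theorem IsCone.simplyConnectedSpace (hc : IsCone hK x₀ c) :
    SimplyConnectedSpace (Realization K) := by
  rw [simply_connected_iff_paths_homotopic']
  have hj : ∀ p, Joined (vertexPoint K x₀ (hK x₀)) p := fun p =>
    (Path.Homotopic.Quotient.mk_surjective (coneClass hK c p)).nonempty
  refine ⟨⟨⟨vertexPoint K x₀ (hK x₀)⟩, fun p q => (hj p).symm.trans (hj q)⟩, fun {a b} p q => ?_⟩
  rw [← Path.Homotopic.Quotient.eq]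
  have h := (hc.coneClass_trans p).trans (hc.coneClass_trans q).symm
  have h2 := congrArg (fun z => (coneClass hK c a).symm.trans z) h
  simpa [← Path.Homotopic.Quotient.trans_assoc] using h2

end Cone

/-! ### Complexes in which loops of length four are nullhomotopic -/

section EdgeClass

variable {V : Type*} {K : PreAbstractSimplicialComplex V}

/-- The class of the path along an edge. -/
def edgeClass (hK : ∀ v, ∃ s ∈ K.faces, v ∈ s) {v w : V} (h : Edge K v w) :
    Path.Homotopic.Quotient (vertexPoint K v (hK v)) (vertexPoint K w (hK w)) :=
  .mk (edgePath h)

variable (hK : ∀ v, ∃ s ∈ K.faces, v ∈ s)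

theorem edgePath_symm {v w : V} (h : Edge K v w) : edgePath h.symm = (edgePath h).symm := by
  refine Path.ext (funext fun t => Subtype.ext ?_)
  rw [isStraight_edgePath]
  refine Eq.trans ?_ (isStraight_edgePath h (unitInterval.symm t)).symm
  simp [add_comm]

theorem edgeClass_trans_symm {v w : V} (h : Edge K v w) (h' : Edge K w v) :
    (edgeClass hK h).trans (edgeClass hK h') = .refl _ := by
  have : edgeClass hK h' = (edgeClass hK h).symm := by
    rw [edgeClass, edgeClass, ← Path.Homotopic.Quotient.mk_symm, ← edgePath_symm h]
  rw [this, Path.Homotopic.Quotient.trans_symm]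

theorem trans_edgeClass_cancel {p : Realization K} {v w : V}
    (q : Path.Homotopic.Quotient p (vertexPoint K v (hK v))) (h : Edge K v w) (h' : Edge K w v) :
    (q.trans (edgeClass hK h)).trans (edgeClass hK h') = q := by
  rw [Path.Homotopic.Quotient.trans_assoc, edgeClass_trans_symm,
    Path.Homotopic.Quotient.trans_refl]

theorem edgeClass_trans_of_face {x y z : V} (hxy : Edge K x y) (hyz : Edge K y z)
    (hxz : Edge K x z) (h : ∃ s ∈ K.faces, x ∈ s ∧ y ∈ s ∧ z ∈ s) :
    (edgeClass hK hxy).trans (edgeClass hK hyz) = edgeClass hK hxz := by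
  obtain ⟨s, hs, hx, hy, hz⟩ := h
  exact (Path.Homotopic.Quotient.mk_trans _ _).symm.trans (Path.Homotopic.Quotient.eq.2
    (IsStraight.trans_homotopic (s := ⟨s, hs⟩) (supportedIn_vertexPoint _ hx)
      (supportedIn_vertexPoint _ hy) (supportedIn_vertexPoint _ hz) (isStraight_edgePath hxy)
      (isStraight_edgePath hyz) (isStraight_edgePath hxz)))

theorem fourLoop_homotopic_refl_iff {x y z w : V} (hxy : Edge K x y) (hyz : Edge K y z)
    (hzw : Edge K z w) (hwx : Edge K w x) :
    Path.Homotopic ((((edgePath hxy).trans (edgePath hyz)).trans (edgePath hzw)).trans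
      (edgePath hwx)) (Path.refl _) ↔
    (edgeClass hK hxy).trans (edgeClass hK hyz) =
      (edgeClass hK hwx.symm).trans (edgeClass hK hzw.symm) := by
  rw [← Path.Homotopic.Quotient.eq]
  simp only [Path.Homotopic.Quotient.mk_trans, Path.Homotopic.Quotient.mk_refl]
  change (((edgeClass hK hxy).trans (edgeClass hK hyz)).trans (edgeClass hK hzw)).trans
      (edgeClass hK hwx) = .refl _ ↔ _
  generalize (edgeClass hK hxy).trans (edgeClass hK hyz) = q
  constructor
  · intro h
    rw [← trans_edgeClass_cancel hK q hzw hzw.symm,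
      ← trans_edgeClass_cancel hK (q.trans _) hwx hwx.symm, h,
      Path.Homotopic.Quotient.refl_trans]
  · rintro rfl
    rw [trans_edgeClass_cancel, edgeClass_trans_symm]

/-- Every edge is contained in a triangle. -/
def EdgesInTriangles (K : PreAbstractSimplicialComplex V) : Prop :=
  ∀ x y, Edge K x y → ∃ z, z ≠ x ∧ z ≠ y ∧ ∃ s ∈ K.faces, x ∈ s ∧ y ∈ s ∧ z ∈ s

section FourLoops

variable (h4 : FourLoopsNullhomotopic K)
include h4

theorem FourLoopsNullhomotopic.edgeClass_trans_eq {x y z w : V} (hxy : Edge K x y)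
    (hyz : Edge K y z) (hxw : Edge K x w) (hwz : Edge K w z) :
    (edgeClass hK hxy).trans (edgeClass hK hyz) = (edgeClass hK hxw).trans (edgeClass hK hwz) :=
  (fourLoop_homotopic_refl_iff hK hxy hyz hwz.symm hxw.symm).1 (h4 x y z w _ _ _ _)

/-- Three pairwise adjacent vertices need not span a face. Replacing the edge `x y` by the other two
sides `x w`, `w y` of a filled triangle on it turns the triangle into a loop of length four. -/
theorem FourLoopsNullhomotopic.edgeClass_trans (ht : EdgesInTriangles K) {x y z : V}
    (hxy : Edge K x y) (hyz : Edge K y z) (hxz : Edge K x z) :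
    (edgeClass hK hxy).trans (edgeClass hK hyz) = edgeClass hK hxz := by
  obtain ⟨w, hwx, hwy, s, hs, hx, hy, hw⟩ := ht x y hxy
  have hxw : Edge K x w := ⟨hwx.symm, s, hs, hx, hw⟩
  have hwy : Edge K w y := ⟨hwy, s, hs, hw, hy⟩
  rw [← edgeClass_trans_of_face hK hxw hwy hxy ⟨s, hs, hx, hw, hy⟩,
    h4.edgeClass_trans_eq hK hxw hwy hxz hyz.symm, trans_edgeClass_cancel]

end FourLoops

/-- Joined by an edge path of length at most two. -/
def Near (K : PreAbstractSimplicialComplex V) (x v : V) : Prop :=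
  x = v ∨ Edge K x v ∨ ∃ w, Edge K x w ∧ Edge K w v

/-- The classes of edge paths of length at most two starting at `x`. -/
inductive ShortClass (x : V) :
    ∀ v, Path.Homotopic.Quotient (vertexPoint K x (hK x)) (vertexPoint K v (hK v)) → Prop
  | refl : ShortClass x x (.refl _)
  | edge {v : V} (h : Edge K x v) : ShortClass x v (edgeClass hK h)
  | two {w v : V} (h : Edge K x w) (h' : Edge K w v) :
      ShortClass x v ((edgeClass hK h).trans (edgeClass hK h'))

variable {hK}

theorem ShortClass.near {x v : V} {q} (h : ShortClass hK x v q) : Near K x v := by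
  cases h with
  | refl => exact Or.inl rfl
  | edge h => exact Or.inr (Or.inl h)
  | two h h' => exact Or.inr (Or.inr ⟨_, h, h'⟩)

theorem Near.exists_shortClass {x v : V} (h : Near K x v) : ∃ q, ShortClass hK x v q := by
  rcases h with rfl | h | ⟨w, h, h'⟩
  · exact ⟨_, .refl⟩
  · exact ⟨_, .edge h⟩
  · exact ⟨_, .two h h'⟩

section

variable (h4 : FourLoopsNullhomotopic K) (ht : EdgesInTriangles K)
include h4 ht

/-- Two short paths with common ends close up to a backtracking edge, a triangle or a quadrilateral.
-/
theorem ShortClass.unique {x v : V} {q q'} (h : ShortClass hK x v q) (h' : ShortClass hK x v q') :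
    q = q' := by
  cases h with
  | refl =>
    cases h' with
    | refl => rfl
    | edge h => exact absurd rfl h.1
    | two h h' => exact (edgeClass_trans_symm hK h h').symm
  | edge h =>
    cases h' with
    | refl => exact absurd rfl h.1
    | edge h => rfl
    | two h' h'' => exact (h4.edgeClass_trans hK ht h' h'' h).symm
  | two h h'' =>
    cases h' with
    | refl => exact edgeClass_trans_symm hK h h''
    | edge h' => exact h4.edgeClass_trans hK ht h h'' h'
    | two h1 h2 => exact h4.edgeClass_trans_eq hK h h'' h1 h2

variable {x₀ : V} (hpent : ∀ y y', Edge K y y' → x₀ ≠ y → x₀ ≠ y' → ¬ Edge K x₀ y →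
  ¬ Edge K x₀ y' → Near K x₀ y → Near K x₀ y' → ∃ z, Edge K x₀ z ∧ Edge K z y ∧ Edge K z y')
include hpent

theorem ShortClass.trans_edgeClass {v w : V} {q q'} (h : ShortClass hK x₀ v q)
    (h' : ShortClass hK x₀ w q') (e : Edge K v w) : q.trans (edgeClass hK e) = q' := by
  by_cases hv : x₀ = v
  · subst hv
    rw [h.unique h4 ht .refl, h'.unique h4 ht (.edge e), Path.Homotopic.Quotient.refl_trans]
  by_cases hv' : Edge K x₀ v
  · rw [h.unique h4 ht (.edge hv')]
    exact ShortClass.unique h4 ht (.two hv' e) h'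
  by_cases hw : x₀ = w
  · exact absurd (hw ▸ e.symm) hv'
  by_cases hw' : Edge K x₀ w
  · rw [h.unique h4 ht (.two hw' e.symm), trans_edgeClass_cancel]
    exact ShortClass.unique h4 ht (.edge hw') h'
  -- Only here are both ends at distance exactly two. Routing both short paths through the common
  -- neighbour `z` leaves the triangle `z v w`.
  obtain ⟨z, hz, hzv, hzw⟩ := hpent v w e hv hw hv' hw' h.near h'.near
  rw [h.unique h4 ht (.two hz hzv), h'.unique h4 ht (.two hz hzw),
    Path.Homotopic.Quotient.trans_assoc, h4.edgeClass_trans hK ht hzv e hzw]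

/-- If all loops of length four are nullhomotopic, then so are all loops, provided that short paths
fill pentagons and that vertices far from the base point can be avoided. -/
theorem simplyConnectedSpace_of_fourLoopsNullhomotopic (hK : ∀ v, ∃ s ∈ K.faces, v ∈ s)
    (hfar : ∀ v, ¬ Near K x₀ v → (∃ y, Edge K y v) ∧ ∀ y, Edge K y v → Near K x₀ y ∧
      ∀ y', Edge K y' v → y = y' ∨ ∃ z, Near K x₀ z ∧ Edge K y z ∧ Edge K z y') :
    SimplyConnectedSpace (Realization K) := by
  -- For a far vertex the admissible classes go through a neighbour, which is near by `hfar`.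
  let good : ∀ v, Path.Homotopic.Quotient (vertexPoint K x₀ (hK x₀)) (vertexPoint K v (hK v)) →
      Prop := fun v q => ShortClass hK x₀ v q ∨
        (¬ Near K x₀ v ∧ ∃ (y : V) (h : Edge K y v) (q' : _), ShortClass hK x₀ y q' ∧
          q = q'.trans (edgeClass hK h))
  have hex : ∀ v, ∃ q, good v q := by
    intro v
    by_cases hv : Near K x₀ v
    · obtain ⟨q, hq⟩ := hv.exists_shortClass (hK := hK)
      exact ⟨q, Or.inl hq⟩
    · obtain ⟨⟨y, hy⟩, h⟩ := hfar v hv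
      obtain ⟨q, hq⟩ := (h y hy).1.exists_shortClass (hK := hK)
      exact ⟨_, Or.inr ⟨hv, y, hy, q, hq, rfl⟩⟩
  have huniq : ∀ v q q', good v q → good v q' → q = q' := by
    rintro v q q' (h | ⟨hv, y, hy, q₁, hq₁, rfl⟩) (h' | ⟨hv', y', hy', q₂, hq₂, rfl⟩)
    · exact h.unique h4 ht h'
    · exact absurd h.near hv'
    · exact absurd h'.near hv
    · rcases ((hfar v hv).2 y hy).2 y' hy' with rfl | ⟨z, hz, hyz, hzy'⟩
      · rw [hq₁.unique h4 ht hq₂]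
      · obtain ⟨r, hr⟩ := hz.exists_shortClass (hK := hK)
        -- The path `y, v, y'` is replaced by `y, z, y'`, using the loop of length four. The new
        -- path stays among near vertices, where compatibility is known.
        rw [← trans_edgeClass_cancel hK (q₁.trans _) hy'.symm hy',
          Path.Homotopic.Quotient.trans_assoc q₁, h4.edgeClass_trans_eq hK hy hy'.symm hyz hzy',
          ← Path.Homotopic.Quotient.trans_assoc q₁, hq₁.trans_edgeClass h4 ht hpent hr hyz,
          hr.trans_edgeClass h4 ht hpent hq₂ hzy']
  choose c hc using hex
  have hedge : ∀ v w (h : Edge K v w), Near K x₀ v → (c v).trans (edgeClass hK h) = c w := by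
    intro v w h hv
    obtain ⟨q, hq⟩ := hv.exists_shortClass (hK := hK)
    rw [huniq v _ q (hc v) (Or.inl hq)]
    by_cases hw : Near K x₀ w
    · obtain ⟨q', hq'⟩ := hw.exists_shortClass (hK := hK)
      rw [huniq w _ q' (hc w) (Or.inl hq')]
      exact hq.trans_edgeClass h4 ht hpent hq' h
    · exact huniq w _ _ (Or.inr ⟨hw, v, h, q, hq, rfl⟩) (hc w)
  refine IsCone.simplyConnectedSpace (hK := hK) (x₀ := x₀) (c := c) fun v w h => ?_
  change (c v).trans (edgeClass hK h) = c w
  by_cases hv : Near K x₀ v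
  · exact hedge v w h hv
  · have := hedge w v h.symm ((hfar v hv).2 w h.symm).1
    rw [← this, trans_edgeClass_cancel]

end

end EdgeClass

/-! ### The complex of a plane over a field -/

section Plane

variable {F : Type*} [Field F] {U : Subgroup Fˣ}

/-- The `U`-vector represented by a nonzero vector. -/
def toUVector (U : Subgroup Fˣ) (v : Fin 2 → F) (hv : v ≠ 0) : UVector U 2 :=
  ⟨unitMultiples U v, v, hv, rfl⟩

theorem mem_toUVector (v : Fin 2 → F) (hv : v ≠ 0) : v ∈ (toUVector U v hv).1 :=
  ⟨1, U.one_mem, by simp⟩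

theorem exists_eq_toUVector (x : UVector U 2) : ∃ v hv, x = toUVector U v hv := by
  obtain ⟨x, v, hv, rfl⟩ := x
  exact ⟨v, hv, rfl⟩

/-- The determinant of two plane vectors. -/
def cross (v w : Fin 2 → F) : F := v 0 * w 1 - v 1 * w 0

theorem cross_self (v : Fin 2 → F) : cross v v = 0 := by
  simp only [cross]; ring

theorem cross_swap (v w : Fin 2 → F) : cross w v = -cross v w := by
  simp only [cross]; ring

theorem cross_smul_right (c : F) (v w : Fin 2 → F) : cross v (c • w) = c * cross v w := by
  simp only [cross, Pi.smul_apply, smul_eq_mul]; ring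

theorem cross_smul_left (c : F) (v w : Fin 2 → F) : cross (c • v) w = c * cross v w := by
  simp only [cross, Pi.smul_apply, smul_eq_mul]; ring

theorem cross_add_right (u v w : Fin 2 → F) : cross u (v + w) = cross u v + cross u w := by
  simp only [cross, Pi.add_apply]; ring

theorem cross_add_left (u v w : Fin 2 → F) : cross (u + v) w = cross u w + cross v w := by
  simp only [cross, Pi.add_apply]; ring

theorem left_ne_zero_of_cross {v w : Fin 2 → F} (h : cross v w ≠ 0) : v ≠ 0 := by
  rintro rfl
  exact h (by simp [cross])

theorem right_ne_zero_of_cross {v w : Fin 2 → F} (h : cross v w ≠ 0) : w ≠ 0 := by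
  rintro rfl
  exact h (by simp [cross])

theorem exists_cross_eq_one {v : Fin 2 → F} (hv : v ≠ 0) : ∃ w, cross v w = 1 := by
  by_cases h : v 0 = 0
  · have h1 : v 1 ≠ 0 := by
      intro h1
      exact hv (funext fun i => by fin_cases i <;> simp [h, h1])
    exact ⟨![-(v 1)⁻¹, 0], by simp [cross, h1]⟩
  · exact ⟨![0, (v 0)⁻¹], by simp [cross, h]⟩

theorem eq_smul_of_cross_eq_zero {v w : Fin 2 → F} (hv : v ≠ 0) (h : cross v w = 0) :
    ∃ c : F, w = c • v := by
  obtain ⟨u, hu⟩ := exists_cross_eq_one hv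
  refine ⟨cross w u, funext fun i => ?_⟩
  simp only [cross, Pi.smul_apply, smul_eq_mul] at *
  fin_cases i <;> simp
  · linear_combination (-w 0) * hu + u 0 * h
  · linear_combination (-w 1) * hu + u 1 * h

/-- Cramer's rule. -/
theorem eq_add_of_cross_ne_zero {v w : Fin 2 → F} (h : cross v w ≠ 0) (r : Fin 2 → F) :
    r = (cross r w / cross v w) • v + (cross v r / cross v w) • w := by
  have key : ∀ i, cross v w * r i = cross r w * v i + cross v r * w i := by
    intro i
    fin_cases i <;> simp [cross] <;> ring
  funext i
  simp only [Pi.add_apply, Pi.smul_apply, smul_eq_mul]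
  rw [div_mul_eq_mul_div, div_mul_eq_mul_div, ← add_div, ← key, mul_div_cancel_left₀ _ h]

/-- The element `x` of the field lies in the subgroup `U` of units. -/
def InU (U : Subgroup Fˣ) (x : F) : Prop := ∃ u ∈ U, (u : F) = x

theorem InU.ne_zero {x : F} (h : InU U x) : x ≠ 0 := by
  obtain ⟨u, -, rfl⟩ := h
  exact u.ne_zero

theorem inU_one : InU U (1 : F) := ⟨1, U.one_mem, rfl⟩

theorem InU.mul {x y : F} (hx : InU U x) (hy : InU U y) : InU U (x * y) := by
  obtain ⟨u, hu, rfl⟩ := hx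
  obtain ⟨v, hv, rfl⟩ := hy
  exact ⟨u * v, U.mul_mem hu hv, rfl⟩

theorem InU.inv {x : F} (hx : InU U x) : InU U x⁻¹ := by
  obtain ⟨u, hu, rfl⟩ := hx
  exact ⟨u⁻¹, U.inv_mem hu, by simp⟩

theorem InU.div {x y : F} (hx : InU U x) (hy : InU U y) : InU U (x / y) := by
  rw [div_eq_mul_inv]
  exact hx.mul hy.inv

theorem InU.mul_iff {x y : F} (hx : InU U x) : InU U (x * y) ↔ InU U y :=
  ⟨fun h => by simpa [hx.ne_zero] using hx.inv.mul h, hx.mul⟩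

theorem toUVector_eq_of_smul {v w : Fin 2 → F} {hv : v ≠ 0} {hw : w ≠ 0} {c : F} (hc : InU U c)
    (h : w = c • v) : toUVector U v hv = toUVector U w hw := by
  obtain ⟨u, hu, rfl⟩ := hc
  exact eq_of_mem (v := w) ⟨u, hu, h⟩ (mem_toUVector w hw)

theorem toUVector_ne_of_cross {v w : Fin 2 → F} {hv : v ≠ 0} {hw : w ≠ 0} (h : cross v w ≠ 0) :
    toUVector U v hv ≠ toUVector U w hw := by
  intro e
  have : w ∈ (toUVector U v hv).1 := e ▸ mem_toUVector w hw
  obtain ⟨c, -, hc⟩ := this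
  rw [hc, Units.smul_def, cross_smul_right, cross_self, mul_zero] at h
  exact h rfl

open Classical in
theorem isDetPartialUBasis_pair {v w : Fin 2 → F} {hv : v ≠ 0} {hw : w ≠ 0}
    (h : InU U (cross v w) ∨ InU U (-cross v w)) :
    IsDetPartialUBasis {toUVector U v hv, toUVector U w hw} := by
  have h0 : cross v w ≠ 0 := by
    rcases h with h | h
    · exact h.ne_zero
    · exact neg_ne_zero.1 h.ne_zero
  constructor
  · have hdet : IsUnit ((Pi.basisFun F (Fin 2)).det ![v, w]) := by
      have : (Pi.basisFun F (Fin 2)).det ![v, w] = cross v w := by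
        rw [Pi.basisFun_det_apply, Matrix.det_fin_two]
        simp [cross]
      rw [this]
      exact h0.isUnit
    have hb := (Module.Basis.is_basis_iff_det (Pi.basisFun F (Fin 2))).2 hdet
    refine ⟨Module.Basis.mk hb.1 hb.2.ge, fun x hx => ?_⟩
    rcases Finset.mem_insert.1 hx with rfl | hx
    · exact ⟨0, by simpa using mem_toUVector v hv⟩
    · rw [Finset.mem_singleton.1 hx]
      exact ⟨1, by simpa using mem_toUVector w hw⟩
  · intro _
    rcases h with ⟨u, hu, h⟩ | ⟨u, hu, h⟩
    · refine ⟨![v, w], fun x hx => ?_, u, hu, ?_⟩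
      · rcases Finset.mem_insert.1 hx with rfl | hx
        · exact ⟨0, by simpa using mem_toUVector v hv⟩
        · rw [Finset.mem_singleton.1 hx]
          exact ⟨1, by simpa using mem_toUVector w hw⟩
      · rw [Matrix.det_transpose, Matrix.det_fin_two, h]
        simp [cross]
    · refine ⟨![w, v], fun x hx => ?_, u, hu, ?_⟩
      · rcases Finset.mem_insert.1 hx with rfl | hx
        · exact ⟨1, by simpa using mem_toUVector v hv⟩
        · rw [Finset.mem_singleton.1 hx]
          exact ⟨0, by simpa using mem_toUVector w hw⟩
      · rw [Matrix.det_transpose, Matrix.det_fin_two, h]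
        simp [cross]
        ring

/-- An augmented basis has at least three elements, so an edge must itself be a determinant-`U`
basis. Changing representatives multiplies the determinant by an element of `U`; the two
alternatives reflect the two orderings. -/
theorem edge_toUVector_iff {v w : Fin 2 → F} {hv : v ≠ 0} {hw : w ≠ 0} :
    Edge (BDA U 2) (toUVector U v hv) (toUVector U w hw) ↔
      InU U (cross v w) ∨ InU U (-cross v w) := by
  classical
  constructor
  · rintro ⟨hne, s, hs, hvs, hws⟩
    have hcard := Finset.card_pair hne
    have hdet : IsDetPartialUBasis {toUVector U v hv, toUVector U w hw} := by
      have hsub : ({toUVector U v hv, toUVector U w hw} : Finset (UVector U 2)) ⊆ s := by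
        intro x hx
        rcases Finset.mem_insert.1 hx with rfl | hx
        · exact hvs
        · rwa [Finset.mem_singleton.1 hx]
      rcases ((BDA U 2).isRelLowerSet_faces hs).2 hsub ⟨_, Finset.mem_insert_self _ _⟩ with ⟨-, h | h⟩
      · exact h
      · obtain ⟨t, x₀, hx₀, hst, -, x₁, h₁, x₂, h₂, h12, -⟩ := h
        rw [hst, Finset.card_cons] at hcard
        have := Finset.one_lt_card.2 ⟨x₁, h₁, x₂, h₂, h12⟩
        omega
    obtain ⟨b, hb, u, hu, hbu⟩ := hdet.2 hcard
    obtain ⟨i, c, hc, hi⟩ := hb _ (Finset.mem_insert_self _ _)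
    obtain ⟨j, d, hd, hj⟩ := hb (toUVector U w hw) (by simp)
    have hij : i ≠ j := by
      rintro rfl
      exact hne (eq_of_mem (v := b i) ⟨c, hc, hi⟩ ⟨d, hd, hj⟩)
    have hcd : InU U ((c : F) * d) := InU.mul ⟨c, hc, rfl⟩ ⟨d, hd, rfl⟩
    have hbij : cross (b i) (b j) = (c * d) * cross v w := by
      rw [hi, hj, Units.smul_def, Units.smul_def, cross_smul_left, cross_smul_right, mul_assoc]
    rw [Matrix.det_transpose, Matrix.det_fin_two] at hbu
    have hcase : (i = 0 ∧ j = 1) ∨ (i = 1 ∧ j = 0) := by omega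
    rcases hcase with ⟨rfl, rfl⟩ | ⟨rfl, rfl⟩
    · left
      rw [← hcd.mul_iff, ← hbij]
      exact ⟨u, hu, by rw [← hbu]; simp [cross]⟩
    · right
      rw [← hcd.mul_iff, mul_neg, ← hbij]
      exact ⟨u, hu, by rw [← hbu]; simp [cross]; ring⟩
  · intro h
    have h0 : cross v w ≠ 0 := by
      rcases h with h | h
      · exact h.ne_zero
      · exact neg_ne_zero.1 h.ne_zero
    exact ⟨toUVector_ne_of_cross h0, {toUVector U v hv, toUVector U w hw}, ⟨⟨_, Finset.mem_insert_self _ _⟩,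
      Or.inl (isDetPartialUBasis_pair h)⟩, by simp, by simp⟩

theorem exists_face_triple {v w r : Fin 2 → F} {hv : v ≠ 0} {hw : w ≠ 0} {hr : r ≠ 0}
    (h : InU U (cross v w) ∨ InU U (-cross v w)) {a b : F} (ha : InU U a) (hb : InU U b)
    (hrab : r = a • v + b • w) : ∃ s ∈ (BDA U 2).faces,
      toUVector U v hv ∈ s ∧ toUVector U w hw ∈ s ∧ toUVector U r hr ∈ s := by
  classical
  have h0 : cross v w ≠ 0 := by
    rcases h with h | h
    · exact h.ne_zero
    · exact neg_ne_zero.1 h.ne_zero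
  have hrv : toUVector U r hr ∉
      ({toUVector U v hv, toUVector U w hw} : Finset (UVector U 2)) := by
    rw [Finset.mem_insert, Finset.mem_singleton, not_or]
    constructor
    · refine toUVector_ne_of_cross ?_
      rw [cross_swap, hrab, cross_add_right, cross_smul_right, cross_smul_right, cross_self]
      simp [hb.ne_zero, h0]
    · refine toUVector_ne_of_cross ?_
      rw [hrab, cross_add_left, cross_smul_left, cross_smul_left, cross_self]
      simp [ha.ne_zero, h0]
  obtain ⟨c, hc, rfl⟩ := ha
  obtain ⟨d, hd, rfl⟩ := hb
  refine ⟨Finset.cons _ _ hrv, ⟨Finset.cons_nonempty _, Or.inr ⟨_, _, hrv, rfl,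
    isDetPartialUBasis_pair h, toUVector U v hv, by simp, toUVector U w hw, by simp,
    toUVector_ne_of_cross h0, r, mem_toUVector r hr, v, mem_toUVector v hv, w, mem_toUVector w hw,
    c, hc, d, hd, hrab⟩⟩, by simp, by simp, by simp⟩

theorem exists_face_mem (x : UVector U 2) : ∃ s ∈ (BDA U 2).faces, x ∈ s := by
  obtain ⟨v, hv, rfl⟩ := exists_eq_toUVector x
  obtain ⟨w, h⟩ := exists_cross_eq_one hv
  have hw : w ≠ 0 := right_ne_zero_of_cross (by rw [h]; exact one_ne_zero)
  exact (edge_toUVector_iff (hw := hw).2 (Or.inl (h ▸ inU_one))).left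

/-- The sum of representatives of the two ends supplies the third vertex. -/
theorem edgesInTriangles_BDA : EdgesInTriangles (BDA U 2) := by
  intro x y h
  obtain ⟨v, hv, rfl⟩ := exists_eq_toUVector x
  obtain ⟨w, hw, rfl⟩ := exists_eq_toUVector y
  have h0 : cross v w ≠ 0 := by
    rcases edge_toUVector_iff.1 h with h | h
    · exact h.ne_zero
    · exact neg_ne_zero.1 h.ne_zero
  have h1 : cross (v + w) w ≠ 0 := by rwa [cross_add_left, cross_self, add_zero]
  have h2 : cross (v + w) v ≠ 0 := by
    rw [cross_add_left, cross_self, zero_add, cross_swap]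
    exact neg_ne_zero.2 h0
  exact ⟨toUVector U (v + w) (left_ne_zero_of_cross h1), toUVector_ne_of_cross h2,
    toUVector_ne_of_cross h1,
    exists_face_triple (edge_toUVector_iff.1 h) inU_one inU_one (by simp)⟩

end Plane

/-! ### Loops of length four suffice -/

section IndexTwo

variable {F : Type*} [Field F] {U : Subgroup Fˣ}

theorem InU.neg (hneg : -1 ∈ U) {x : F} (h : InU U x) : InU U (-x) := by
  obtain ⟨u, hu, rfl⟩ := h
  exact ⟨-1 * u, U.mul_mem hneg hu, by simp⟩

theorem edge_toUVector_iff_of_neg_one_mem (hneg : -1 ∈ U) {v w : Fin 2 → F} {hv : v ≠ 0}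
    {hw : w ≠ 0} : Edge (BDA U 2) (toUVector U v hv) (toUVector U w hw) ↔ InU U (cross v w) := by
  rw [edge_toUVector_iff]
  exact ⟨fun h => h.elim id fun h => by simpa using h.neg hneg, Or.inl⟩

theorem mul_inU_of_not (hidx : ∀ a b : Fˣ, a ∉ U → b ∉ U → a * b ∈ U) {x y : F} (hx : x ≠ 0)
    (hy : y ≠ 0) (hxU : ¬ InU U x) (hyU : ¬ InU U y) : InU U (x * y) :=
  ⟨Units.mk0 x hx * Units.mk0 y hy, hidx _ _ (fun h => hxU ⟨_, h, rfl⟩)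
    (fun h => hyU ⟨_, h, rfl⟩), rfl⟩

theorem div_inU_of_not (hidx : ∀ a b : Fˣ, a ∉ U → b ∉ U → a * b ∈ U) {x y : F} (hx : x ≠ 0)
    (hy : y ≠ 0) (hxU : ¬ InU U x) (hyU : ¬ InU U y) : InU U (x / y) := by
  have h := mul_inU_of_not hidx hx hy hxU hyU
  have h2 := (mul_inU_of_not hidx hy hy hyU hyU).inv.mul h
  convert h2 using 1
  field_simp

/-- Dividing by `cross x y` makes the determinants with `x` and `y` equal to `u` and `1`, whether or
not `cross x y` lies in `U`. -/
theorem exists_common_neighbor {x y : Fin 2 → F} {hx : x ≠ 0} {hy : y ≠ 0}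
    (h : cross x y ≠ 0) {u : F} (hu : InU U u) : ∃ hz : (cross x y)⁻¹ • (x + u • y) ≠ 0,
      Edge (BDA U 2) (toUVector U x hx) (toUVector U _ hz) ∧
      Edge (BDA U 2) (toUVector U _ hz) (toUVector U y hy) := by
  have h1 : cross x ((cross x y)⁻¹ • (x + u • y)) = u := by
    rw [cross_smul_right, cross_add_right, cross_smul_right, cross_self]
    field_simp
    ring
  have h2 : cross ((cross x y)⁻¹ • (x + u • y)) y = 1 := by
    rw [cross_smul_left, cross_add_left, cross_smul_left, cross_self]
    field_simp
    ring
  refine ⟨right_ne_zero_of_cross (h1 ▸ hu.ne_zero), ?_, ?_⟩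
  · exact edge_toUVector_iff.2 (Or.inl (h1.symm ▸ hu))
  · exact edge_toUVector_iff.2 (Or.inl (h2.symm ▸ inU_one))

theorem near_of_cross_ne_zero {x y : Fin 2 → F} {hx : x ≠ 0} {hy : y ≠ 0} (h : cross x y ≠ 0) :
    Near (BDA U 2) (toUVector U x hx) (toUVector U y hy) := by
  obtain ⟨hz, h1, h2⟩ := exists_common_neighbor (hx := hx) (hy := hy) h (inU_one (U := U))
  exact Or.inr (Or.inr ⟨_, h1, h2⟩)

theorem cross_ne_zero_of_edge {v w : Fin 2 → F} {hv : v ≠ 0} {hw : w ≠ 0}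
    (h : Edge (BDA U 2) (toUVector U v hv) (toUVector U w hw)) : cross v w ≠ 0 := by
  rcases edge_toUVector_iff.1 h with h | h
  · exact h.ne_zero
  · exact neg_ne_zero.1 h.ne_zero

/-- If `y = c • x`, the determinants of `z` with `x` and with `y` differ by the factor `c`; both lie
in `U`, hence so does `c`. -/
theorem eq_of_cross_eq_zero (hneg : -1 ∈ U) {x y : Fin 2 → F} {hx : x ≠ 0} {hy : y ≠ 0}
    (h : cross x y = 0) {z : UVector U 2} (hxz : Edge (BDA U 2) (toUVector U x hx) z)
    (hzy : Edge (BDA U 2) z (toUVector U y hy)) : toUVector U x hx = toUVector U y hy := by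
  obtain ⟨z, hz, rfl⟩ := exists_eq_toUVector z
  obtain ⟨c, hc⟩ := eq_smul_of_cross_eq_zero hx h
  have h1 := (edge_toUVector_iff_of_neg_one_mem hneg).1 hxz
  have h2 := (edge_toUVector_iff_of_neg_one_mem hneg).1 hzy.symm
  rw [hc, cross_smul_left, mul_comm] at h2
  exact toUVector_eq_of_smul (h1.mul_iff.1 h2) hc

/-- With `p = cross x y`, `q = cross x y'` and `p = u₁ + u₂`, take `z = u₁ • y + (u₂ * (p / q)) •
y'`. Then `cross x z = (u₁ + u₂) * p = p * p`, a product of two elements outside `U`. The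
determinants with `y` and `y'` are, up to sign, `cross y y'` times a coefficient of `z`, and both
coefficients lie in `U`. -/
theorem exists_pentagon_center (hneg : -1 ∈ U)
    (hidx : ∀ a b : Fˣ, a ∉ U → b ∉ U → a * b ∈ U)
    (hsum : ∀ c : Fˣ, c ∉ U → ∃ u₁ ∈ U, ∃ u₂ ∈ U, (c : F) = u₁ + u₂)
    {x y y' : UVector U 2} (h : Edge (BDA U 2) y y') (hy : x ≠ y) (hy' : x ≠ y')
    (hxy : ¬ Edge (BDA U 2) x y) (hxy' : ¬ Edge (BDA U 2) x y') (hn : Near (BDA U 2) x y)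
    (hn' : Near (BDA U 2) x y') :
    ∃ z, Edge (BDA U 2) x z ∧ Edge (BDA U 2) z y ∧ Edge (BDA U 2) z y' := by
  obtain ⟨z, hxz, hzy⟩ := (hn.resolve_left hy).resolve_left hxy
  obtain ⟨z', hxz', hzy'⟩ := (hn'.resolve_left hy').resolve_left hxy'
  obtain ⟨x, hx, rfl⟩ := exists_eq_toUVector x
  obtain ⟨y, hy0, rfl⟩ := exists_eq_toUVector y
  obtain ⟨y', hy0', rfl⟩ := exists_eq_toUVector y'
  have hp : cross x y ≠ 0 := fun h => hy (eq_of_cross_eq_zero hneg h hxz hzy)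
  have hq : cross x y' ≠ 0 := fun h => hy' (eq_of_cross_eq_zero hneg h hxz' hzy')
  rw [edge_toUVector_iff_of_neg_one_mem hneg] at h hxy hxy'
  have hqp := div_inU_of_not hidx hp hq hxy hxy'
  obtain ⟨u₁, hu₁, u₂, hu₂, hu⟩ := hsum (Units.mk0 _ hp) fun h => hxy ⟨_, h, rfl⟩
  rw [Units.val_mk0] at hu
  have hb : InU U ((u₂ : F) * (cross x y / cross x y')) := InU.mul ⟨u₂, hu₂, rfl⟩ hqp
  have ha : InU U (u₁ : F) := ⟨u₁, hu₁, rfl⟩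
  have h1 : cross x ((u₁ : F) • y + ((u₂ : F) * (cross x y / cross x y')) • y') =
      cross x y * cross x y := by
    rw [cross_add_right, cross_smul_right, cross_smul_right]
    field_simp
    rw [hu]
  have h1U := mul_inU_of_not hidx hp hp hxy hxy
  rw [← h1] at h1U
  refine ⟨toUVector U _ (right_ne_zero_of_cross h1U.ne_zero), ?_, ?_, ?_⟩
  · exact (edge_toUVector_iff_of_neg_one_mem hneg).2 h1U
  · refine Edge.symm ((edge_toUVector_iff_of_neg_one_mem hneg).2 ?_)
    rw [cross_add_right, cross_smul_right, cross_smul_right, cross_self, mul_zero, zero_add]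
    exact hb.mul h
  · refine (edge_toUVector_iff_of_neg_one_mem hneg).2 ?_
    rw [cross_add_left, cross_smul_left, cross_smul_left, cross_self, mul_zero, add_zero]
    exact ha.mul h

theorem exists_near_bypass (hneg : -1 ∈ U)
    (hsum : ∀ c : Fˣ, c ∉ U → ∃ u₁ ∈ U, ∃ u₂ ∈ U, (c : F) = u₁ + u₂)
    {x v y y' : UVector U 2} (hv : ¬ Near (BDA U 2) x v) (hy : Edge (BDA U 2) y v)
    (hy' : Edge (BDA U 2) y' v) : Near (BDA U 2) x y ∧
      (y = y' ∨ ∃ z, Near (BDA U 2) x z ∧ Edge (BDA U 2) y z ∧ Edge (BDA U 2) z y') := by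
  obtain ⟨x, hx, rfl⟩ := exists_eq_toUVector x
  obtain ⟨v, hv0, rfl⟩ := exists_eq_toUVector v
  have hxv : cross x v = 0 := by
    by_contra h
    exact hv (near_of_cross_ne_zero h)
  obtain ⟨c, rfl⟩ := eq_smul_of_cross_eq_zero hx hxv
  have hne : ∀ z hz, Edge (BDA U 2) (toUVector U z hz) (toUVector U (c • x) hv0) →
      cross x z ≠ 0 := by
    intro z hz h
    have := cross_ne_zero_of_edge h.symm
    rw [cross_smul_left] at this
    exact right_ne_zero_of_mul this
  by_cases hyy' : y = y'
  · obtain ⟨y, hy0, rfl⟩ := exists_eq_toUVector y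
    exact ⟨near_of_cross_ne_zero (hne _ _ hy), Or.inl hyy'⟩
  have hyy0 : ¬ (∃ z hz z' hz', y = toUVector U z hz ∧ y' = toUVector U z' hz' ∧
      cross z z' = 0) := by
    rintro ⟨z, hz, z', hz', rfl, rfl, h⟩
    exact hyy' (eq_of_cross_eq_zero hneg h hy hy'.symm)
  obtain ⟨y, hy0, rfl⟩ := exists_eq_toUVector y
  obtain ⟨y', hy0', rfl⟩ := exists_eq_toUVector y'
  have hp := hne _ _ hy
  have hq := hne _ _ hy'
  refine ⟨near_of_cross_ne_zero hp, Or.inr ?_⟩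
  have he : cross y y' ≠ 0 := fun h => hyy0 ⟨_, _, _, _, rfl, rfl, h⟩
  -- two distinct elements of `U`, at least one of which avoids the line of `x`
  have hc0 : c ≠ 0 := by
    rintro rfl
    exact hv0 (zero_smul F x)
  have hcU : Units.mk0 c hc0 ∉ U := by
    intro h
    refine hv (Or.inl (toUVector_eq_of_smul (c := c) ⟨_, h, rfl⟩ rfl))
  obtain ⟨u₁, hu₁, u₂, hu₂, hu⟩ := hsum _ hcU
  have hu1 : InU U (u₁ : F) := ⟨u₁, hu₁, rfl⟩
  have hu2 : InU U (-(u₂ : F)) := InU.neg hneg ⟨u₂, hu₂, rfl⟩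
  -- The candidates `u₁` and `-u₂` differ by `c ≠ 0`, so the expression, affine in `u` with slope
  -- `cross x y' ≠ 0`, cannot vanish at both.
  obtain ⟨u, huU, hz⟩ : ∃ u : F, InU U u ∧ cross x y + u * cross x y' ≠ 0 := by
    by_contra! h
    have h1 := h _ hu1
    have h2 := h _ hu2
    have h3 : (Units.mk0 c hc0 : F) * cross x y' = 0 := by
      rw [hu]
      linear_combination h1 - h2
    exact mul_ne_zero (Units.ne_zero _) hq h3
  obtain ⟨hz0, h1, h2⟩ := exists_common_neighbor (hx := hy0) (hy := hy0') he huU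
  refine ⟨_, near_of_cross_ne_zero ?_, h1, h2⟩
  rw [cross_smul_right, cross_add_right, cross_smul_right]
  exact mul_ne_zero (inv_ne_zero he) hz

theorem simplyConnectedSpace_BDA_of_fourLoopsNullhomotopic
    (hidx : ∀ a b : Fˣ, a ∉ U → b ∉ U → a * b ∈ U)
    (hsum : ∀ c : Fˣ, c ∉ U → ∃ u₁ ∈ U, ∃ u₂ ∈ U, (c : F) = u₁ + u₂)
    (h4 : FourLoopsNullhomotopic (BDA U 2)) :
    SimplyConnectedSpace (Realization (BDA U 2)) := by
  have h10 : (![1, 0] : Fin 2 → F) ≠ 0 := fun h => one_ne_zero (congrFun h 0)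
  by_cases hneg : -1 ∈ U
  · refine simplyConnectedSpace_of_fourLoopsNullhomotopic h4 edgesInTriangles_BDA
      (x₀ := toUVector U ![1, 0] h10)
      (fun y y' h h1 h2 h3 h5 => exists_pentagon_center hneg hidx hsum h h1 h2 h3 h5)
      exists_face_mem fun v hv => ⟨?_, fun y hy => ⟨(exists_near_bypass hneg hsum hv hy hy).1,
        fun y' hy' => (exists_near_bypass hneg hsum hv hy hy').2⟩⟩
    obtain ⟨v, hv0, rfl⟩ := exists_eq_toUVector v
    obtain ⟨w, hw⟩ := exists_cross_eq_one hv0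
    have hw1 : InU U (cross v w) := hw ▸ inU_one
    exact ⟨toUVector U w (right_ne_zero_of_cross hw1.ne_zero),
      (edge_toUVector_iff.2 (Or.inl hw1)).symm⟩
  -- When `-1 ∉ U`, the other coset is `-U`. Every vertex is near the base vertex, and two vertices
  -- not adjacent to it lie on its line, so they are not adjacent to each other.
  · have hall : ∀ x : F, x ≠ 0 → InU U x ∨ InU U (-x) := by
      intro x hx
      by_cases h : Units.mk0 x hx ∈ U
      · exact Or.inl ⟨_, h, rfl⟩
      · exact Or.inr ⟨_, hidx _ _ hneg h, by simp⟩
    have hedge : ∀ {v w : Fin 2 → F} {hv : v ≠ 0} {hw : w ≠ 0},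
        Edge (BDA U 2) (toUVector U v hv) (toUVector U w hw) ↔ cross v w ≠ 0 :=
      ⟨cross_ne_zero_of_edge, fun h => edge_toUVector_iff.2 (hall _ h)⟩
    have hnear : ∀ v, Near (BDA U 2) (toUVector U ![1, 0] h10) v := by
      intro v
      obtain ⟨v, hv0, rfl⟩ := exists_eq_toUVector v
      by_cases h : cross ![1, 0] v = 0
      · obtain ⟨w, hw⟩ := exists_cross_eq_one hv0
        have hw0 : cross v w ≠ 0 := by rw [hw]; exact one_ne_zero
        obtain ⟨c, rfl⟩ := eq_smul_of_cross_eq_zero h10 h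
        refine Or.inr (Or.inr ⟨toUVector U w (right_ne_zero_of_cross hw0), ?_, ?_⟩)
        · rw [hedge]
          rw [cross_smul_left] at hw0
          exact right_ne_zero_of_mul hw0
        · exact (hedge.2 hw0).symm
      · exact near_of_cross_ne_zero h
    refine simplyConnectedSpace_of_fourLoopsNullhomotopic h4 edgesInTriangles_BDA
      (x₀ := toUVector U ![1, 0] h10) ?_ exists_face_mem fun v hv => absurd (hnear v) hv
    intro y y' h _ _ h1 h2 _ _
    obtain ⟨y, hy0, rfl⟩ := exists_eq_toUVector y
    obtain ⟨y', hy0', rfl⟩ := exists_eq_toUVector y'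
    rw [hedge, not_not] at h1 h2
    obtain ⟨c, rfl⟩ := eq_smul_of_cross_eq_zero h10 h1
    rw [hedge, cross_smul_left, h2, mul_zero] at h
    exact absurd rfl h

theorem fourLoopsNullhomotopic_of_simplyConnectedSpace {V : Type*}
    {K : PreAbstractSimplicialComplex V} (_h : SimplyConnectedSpace (Realization K)) :
    FourLoopsNullhomotopic K :=
  fun _ _ _ _ _ _ _ _ => SimplyConnectedSpace.paths_homotopic _ _

end IndexTwo

/-! ### Filling loops of length four -/

section Fill

variable {F : Type*} [Field F] {U : Subgroup Fˣ}

/-- When `-1 ∈ U`, Cramer's rule gives the coefficients of `z` in terms of `x` and `y` as quotients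
of elements of `U`, so the clique is an augmented basis. -/
theorem exists_face_of_clique (hneg : -1 ∈ U) {x y z : UVector U 2} (hxy : Edge (BDA U 2) x y)
    (hyz : Edge (BDA U 2) y z) (hxz : Edge (BDA U 2) x z) :
    ∃ s ∈ (BDA U 2).faces, x ∈ s ∧ y ∈ s ∧ z ∈ s := by
  obtain ⟨x, hx, rfl⟩ := exists_eq_toUVector x
  obtain ⟨y, hy, rfl⟩ := exists_eq_toUVector y
  obtain ⟨z, hz, rfl⟩ := exists_eq_toUVector z
  rw [edge_toUVector_iff_of_neg_one_mem hneg] at hxy hxz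
  have hzy := (edge_toUVector_iff_of_neg_one_mem hneg).1 hyz.symm
  exact exists_face_triple (Or.inl hxy) (hzy.div hxy) (hxz.div hxy)
    (eq_add_of_cross_ne_zero hxy.ne_zero z)

theorem fourLoopsNullhomotopic_of_closure (hneg : -1 ∈ U)
    (hidx : ∀ a b : Fˣ, a ∉ U → b ∉ U → a * b ∈ U) {T : Set Fˣ} (hT : Subgroup.closure T = U)
    (hgen : ∀ g ∈ T, (1 : F) - g ≠ 0 ∧ ¬ InU U ((1 : F) - g)) :
    FourLoopsNullhomotopic (BDA U 2) := by
  have htri : ∀ {x y z : UVector U 2} (hxy : Edge (BDA U 2) x y) (hyz : Edge (BDA U 2) y z)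
      (hxz : Edge (BDA U 2) x z), (edgeClass exists_face_mem hxy).trans
        (edgeClass exists_face_mem hyz) = edgeClass exists_face_mem hxz :=
    fun hxy hyz hxz => edgeClass_trans_of_face _ hxy hyz hxz
      (exists_face_of_clique hneg hxy hyz hxz)
  intro x y z w hxy hyz hzw hwx
  refine (fourLoop_homotopic_refl_iff exists_face_mem hxy hyz hzw hwx).2 ?_
  by_cases hxz : x = z
  · subst hxz
    rw [edgeClass_trans_symm, edgeClass_trans_symm]
  by_cases hxz' : Edge (BDA U 2) x z
  · rw [htri hxy hyz hxz', htri hwx.symm hzw.symm hxz']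
  obtain ⟨x, hx, rfl⟩ := exists_eq_toUVector x
  obtain ⟨z, hz, rfl⟩ := exists_eq_toUVector z
  have hd : cross x z ≠ 0 := fun h => hxz (eq_of_cross_eq_zero hneg h hxy hyz)
  rw [edge_toUVector_iff_of_neg_one_mem hneg] at hxz'
  have hY0 : ∀ b : U, (cross x z)⁻¹ • (x + ((b : Fˣ) : F) • z) ≠ 0 := fun b =>
    (exists_common_neighbor (hx := hx) (hy := hz) hd (U := U) ⟨b, b.2, rfl⟩).1
  let Y : U → UVector U 2 := fun b => toUVector U _ (hY0 b)
  have hxY : ∀ b, Edge (BDA U 2) (toUVector U x hx) (Y b) := fun b =>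
    (exists_common_neighbor (hx := hx) (hy := hz) hd (U := U) ⟨b, b.2, rfl⟩).2.1
  have hYz : ∀ b, Edge (BDA U 2) (Y b) (toUVector U z hz) := fun b =>
    (exists_common_neighbor (hx := hx) (hy := hz) hd (U := U) ⟨b, b.2, rfl⟩).2.2
  -- Scaling `y` so that its determinant with `z` becomes 1 brings it to the form `Y b` with `b =
  -- cross x y / cross y z`.
  have hY : ∀ y, Edge (BDA U 2) (toUVector U x hx) y → Edge (BDA U 2) y (toUVector U z hz) →
      ∃ b, y = Y b := by
    intro y hxy hyz
    obtain ⟨y, hy, rfl⟩ := exists_eq_toUVector y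
    rw [edge_toUVector_iff_of_neg_one_mem hneg] at hxy hyz
    obtain ⟨b, hb, hbe⟩ := hxy.div hyz
    refine ⟨⟨b, hb⟩, (toUVector_eq_of_smul hyz ?_).symm⟩
    have := hyz.ne_zero
    rw [hbe]
    conv_lhs => rw [eq_add_of_cross_ne_zero hd y]
    simp only [smul_add, smul_smul]
    congr 2 <;> field_simp
  let f : U → Path.Homotopic.Quotient _ _ := fun b =>
    (edgeClass exists_face_mem (hxY b)).trans (edgeClass exists_face_mem (hYz b))
  -- The determinant of `Y (g * b)` and `Y b` is `b * (1 - g) / cross x z`. Numerator factor `1 - g`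
  -- and denominator both lie outside `U`, so the quotient is in `U` and two filled triangles join
  -- the paths.
  have hstep : ∀ g : U, (g : Fˣ) ∈ T → ∀ b, f (g * b) = f b := by
    intro g hg b
    obtain ⟨h0, hU⟩ := hgen g hg
    have he : Edge (BDA U 2) (Y (g * b)) (Y b) := by
      refine (edge_toUVector_iff_of_neg_one_mem hneg).2 ?_
      have : cross ((cross x z)⁻¹ • (x + (((g * b : U) : Fˣ) : F) • z))
          ((cross x z)⁻¹ • (x + ((b : Fˣ) : F) • z)) =
          ((b : Fˣ) : F) * ((1 - ((g : Fˣ) : F)) / cross x z) := by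
        simp only [cross_smul_left, cross_smul_right, cross_add_left, cross_add_right, cross_self,
          cross_swap x z, Subgroup.coe_mul, Units.val_mul]
        field_simp
        ring
      rw [this]
      exact InU.mul ⟨b, b.2, rfl⟩ (div_inU_of_not hidx h0 hd hU hxz')
    change (edgeClass exists_face_mem (hxY (g * b))).trans
      (edgeClass exists_face_mem (hYz (g * b))) = (edgeClass exists_face_mem (hxY b)).trans
        (edgeClass exists_face_mem (hYz b))
    rw [← htri (hxY (g * b)) he (hxY b), Path.Homotopic.Quotient.trans_assoc,
      htri he (hYz b) (hYz (g * b))]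
  have hall : ∀ g : Fˣ, ∀ hg : g ∈ Subgroup.closure T, ∀ b, f (⟨g, hT.le hg⟩ * b) = f b := by
    intro g hg
    induction hg using Subgroup.closure_induction with
    | mem g hg => exact hstep ⟨g, _⟩ hg
    | one => exact fun b => congrArg f (one_mul b)
    | mul g h hg hh ihg ihh =>
      intro b
      exact (congrArg f (mul_assoc (⟨g, hT.le hg⟩ : U) ⟨h, hT.le hh⟩ b)).trans
        ((ihg _).trans (ihh b))
    | inv g hg ih =>
      intro b
      exact (ih _).symm.trans
        (congrArg f (mul_inv_cancel_left (⟨g, hT.le hg⟩ : U) b))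
  obtain ⟨b, rfl⟩ := hY y hxy hyz
  obtain ⟨b', rfl⟩ := hY w hwx.symm hzw.symm
  have h1 := hall (b / b' : U) (hT.ge (b / b' : U).2) b'
  exact (congrArg f (div_mul_cancel b b')).symm.trans h1

end Fill

/-! ### The three quotients -/

theorem fourLoopsNullhomotopic_and_simplyConnectedSpace_field {F : Type*} [Field F]
    {U : Subgroup Fˣ} (hneg : -1 ∈ U)
    (hidx : ∀ a b : Fˣ, a ∉ U → b ∉ U → a * b ∈ U)
    (hsum : ∀ c : Fˣ, c ∉ U → ∃ u₁ ∈ U, ∃ u₂ ∈ U, (c : F) = u₁ + u₂)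
    {T : Set Fˣ} (hT : Subgroup.closure T = U)
    (hgen : ∀ g ∈ T, (1 : F) - g ≠ 0 ∧ ∀ u ∈ U, (1 : F) - g ≠ u) :
    FourLoopsNullhomotopic (BDA U 2) ∧ SimplyConnectedSpace (Realization (BDA U 2)) := by
  have h4 := fourLoopsNullhomotopic_of_closure hneg hidx hT fun g hg =>
    ⟨(hgen g hg).1, fun ⟨u, hu, h⟩ => (hgen g hg).2 u hu h.symm⟩
  exact ⟨h4, simplyConnectedSpace_BDA_of_fourLoopsNullhomotopic hidx hsum h4⟩

/-- A criterion in terms of divisibility in `R`: the units of `R` and their multiples by `γ` cover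
the nonzero residues modulo `p`, and `T` generates the units of `R`. -/
theorem fourLoopsNullhomotopic_and_simplyConnectedSpace_quotient {R : Type*} [CommRing R]
    {p γ : R} (hcover : ∀ x : R, p ∣ x ∨ ∃ ε : Rˣ, p ∣ x - ε ∨ p ∣ x - γ * ε)
    (hγ : ∀ ε : Rˣ, ¬ p ∣ γ - ε) (hγ2 : ∃ ε : Rˣ, p ∣ γ * γ - ε)
    (hsum : ∃ ε δ : Rˣ, p ∣ γ - (ε + δ)) {T : Set Rˣ} (hT : Subgroup.closure T = ⊤)
    (hgen : ∀ g ∈ T, ∃ ε : Rˣ, p ∣ 1 - g - γ * ε) :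
    FourLoopsNullhomotopic (BDA (unitImage p) 2) ∧
      SimplyConnectedSpace (Realization (BDA (unitImage p) 2)) := by
  let q := Ideal.Quotient.mk (Ideal.span {p})
  have hq0 : ∀ x, p ∣ x ↔ q x = 0 := fun x =>
    (Ideal.mem_span_singleton.symm.trans Ideal.Quotient.eq_zero_iff_mem.symm)
  have hq : ∀ x y, p ∣ x - y ↔ q x = q y := fun x y => by rw [hq0, map_sub, sub_eq_zero]
  simp only [hq, sub_sub] at hcover hγ hγ2 hsum hgen
  have hunit : ∀ ε : Rˣ, IsUnit (q ε) := fun ε => ε.isUnit.map q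
  have hγu : IsUnit (q γ) := by
    obtain ⟨ε, h⟩ := hγ2
    refine isUnit_of_mul_isUnit_left (y := q γ) ?_
    rw [← map_mul, h]
    exact hunit ε
  have hnontriv : Nontrivial (R ⧸ Ideal.span {p}) := by
    refine ⟨q γ, q (1 : Rˣ), hγ 1⟩
  -- By the covering hypothesis every nonzero residue is a unit or `γ` times a unit, and `γ` is
  -- invertible because its square is a unit modulo `p`.
  have hfield : IsField (R ⧸ Ideal.span {p}) := by
    refine ⟨⟨0, 1, zero_ne_one⟩, mul_comm, fun {a} ha => ?_⟩
    suffices IsUnit a from this.exists_right_inv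
    obtain ⟨x, rfl⟩ := Ideal.Quotient.mk_surjective a
    rcases hcover x with h | ⟨ε, h | h⟩
    · exact absurd ((hq0 x).1 h) ha
    · exact h ▸ hunit ε
    · change IsUnit (q x)
      rw [h, map_mul]
      exact hγu.mul (hunit ε)
  have hmax : (Ideal.span {p}).IsMaximal := Ideal.Quotient.maximal_of_isField _ hfield
  let _ : Field (R ⧸ Ideal.span {p}) := Ideal.Quotient.field _
  let φ : Rˣ →* (R ⧸ Ideal.span {p})ˣ := Units.map q.toMonoidHom
  have hU : ∀ u : (R ⧸ Ideal.span {p})ˣ, u ∈ unitImage p ↔ ∃ ε : Rˣ, q ε = u := fun u =>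
    ⟨fun ⟨ε, h⟩ => ⟨ε, congrArg Units.val h⟩, fun ⟨ε, h⟩ => ⟨ε, Units.ext h⟩⟩
  have hnU : ∀ u : (R ⧸ Ideal.span {p})ˣ, u ∉ unitImage p → ∃ ε : Rˣ, (u : R ⧸ Ideal.span {p}) =
      q γ * q ε := by
    intro u hu
    obtain ⟨x, hx⟩ := Ideal.Quotient.mk_surjective (u : R ⧸ Ideal.span {p})
    change q x = u at hx
    rcases hcover x with h | ⟨ε, h | h⟩
    · exact absurd (hx.symm.trans ((hq0 x).1 h)) u.ne_zero
    · exact absurd ((hU u).2 ⟨ε, h.symm.trans hx⟩) hu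
    · exact ⟨ε, by rw [← hx, h, map_mul]⟩
  refine fourLoopsNullhomotopic_and_simplyConnectedSpace_field (T := φ '' T) ?_ ?_ ?_ ?_ ?_
  · exact (hU _).2 ⟨-1, by simp⟩
  · intro a b ha hb
    obtain ⟨ε, hε⟩ := hnU a ha
    obtain ⟨δ, hδ⟩ := hnU b hb
    obtain ⟨η, hη⟩ := hγ2
    refine (hU _).2 ⟨η * ε * δ, ?_⟩
    rw [map_mul] at hη
    push_cast
    rw [hε, hδ, map_mul, map_mul, ← hη]
    ring
  · intro c hc
    obtain ⟨ε, hε⟩ := hnU c hc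
    obtain ⟨δ, η, h⟩ := hsum
    refine ⟨φ (δ * ε), ⟨_, rfl⟩, φ (η * ε), ⟨_, rfl⟩, ?_⟩
    rw [hε, h]
    change _ = q ((δ * ε : Rˣ) : R) + q ((η * ε : Rˣ) : R)
    simp [add_mul]
  · rw [← MonoidHom.map_closure, hT, ← MonoidHom.range_eq_map]
    rfl
  · rintro _ ⟨g, hg, rfl⟩
    obtain ⟨ε, hε⟩ := hgen g hg
    have h1 : (1 : R ⧸ Ideal.span {p}) - (φ g : R ⧸ Ideal.span {p}) = q γ * q ε := by
      have : q (1 - g - γ * ε) = 0 := by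
        rw [sub_sub, map_sub, hε, sub_self]
      rw [map_sub, map_sub, map_mul, map_one] at this
      exact sub_eq_zero.1 this
    rw [h1]
    refine ⟨(hγu.mul (hunit ε)).ne_zero, fun u hu h => ?_⟩
    obtain ⟨δ, hδ⟩ := (hU u).1 hu
    refine hγ (δ * ε⁻¹) ?_
    have h2 : q (ε : R) * q ((ε⁻¹ : Rˣ) : R) = 1 := by
      rw [← map_mul, Units.mul_inv, map_one]
    push_cast
    rw [map_mul, hδ, ← h, mul_assoc, h2, mul_one]

/-! ### Gaussian integers modulo three -/

/-- The imaginary unit as a unit of the Gaussian integers. -/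
def gaussianI : GaussianIntˣ :=
  ⟨⟨0, 1⟩, ⟨0, -1⟩, by ext <;> simp, by ext <;> simp⟩

theorem gaussian_unit_cases (ε : GaussianIntˣ) :
    ((ε : GaussianInt).re = 1 ∧ (ε : GaussianInt).im = 0) ∨
    ((ε : GaussianInt).re = -1 ∧ (ε : GaussianInt).im = 0) ∨
    ((ε : GaussianInt).re = 0 ∧ (ε : GaussianInt).im = 1) ∨
    ((ε : GaussianInt).re = 0 ∧ (ε : GaussianInt).im = -1) := by
  have h := (Zsqrtd.norm_eq_one_iff' (by norm_num) (ε : GaussianInt)).2 ε.isUnit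
  rw [Zsqrtd.norm_def] at h
  generalize (ε : GaussianInt).re = a at *
  generalize (ε : GaussianInt).im = b at *
  have ha1 : a ≤ 1 := by nlinarith [sq_nonneg a, sq_nonneg b]
  have ha2 : -1 ≤ a := by nlinarith [sq_nonneg a, sq_nonneg b]
  have hb1 : b ≤ 1 := by nlinarith [sq_nonneg a, sq_nonneg b]
  have hb2 : -1 ≤ b := by nlinarith [sq_nonneg a, sq_nonneg b]
  interval_cases a <;> interval_cases b <;> simp at h ⊢

theorem closure_gaussianI : Subgroup.closure {gaussianI} = ⊤ := by
  refine eq_top_iff.2 fun ε _ => ?_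
  have hi : gaussianI ∈ Subgroup.closure {gaussianI} := Subgroup.subset_closure rfl
  rcases gaussian_unit_cases ε with h | h | h | h
  · obtain rfl : ε = 1 := Units.ext (Zsqrtd.ext h.1 h.2)
    exact Subgroup.one_mem _
  · obtain rfl : ε = gaussianI * gaussianI :=
      Units.ext (Zsqrtd.ext (by simp [gaussianI, h.1]) (by simp [gaussianI, h.2]))
    exact Subgroup.mul_mem _ hi hi
  · obtain rfl : ε = gaussianI := Units.ext (Zsqrtd.ext h.1 h.2)
    exact hi
  · obtain rfl : ε = gaussianI⁻¹ := Units.ext (Zsqrtd.ext h.1 h.2)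
    exact Subgroup.inv_mem _ hi

theorem three_dvd_gaussian_iff (z : GaussianInt) : 3 ∣ z ↔ (3 : ℤ) ∣ z.re ∧ (3 : ℤ) ∣ z.im := by
  rw [← Zsqrtd.intCast_dvd]
  norm_num

theorem gaussian_three : FourLoopsNullhomotopic (BDA (unitImage (3 : GaussianInt)) 2) ∧
    SimplyConnectedSpace (Realization (BDA (unitImage (3 : GaussianInt)) 2)) := by
  -- The data are `(1 + i)² = 2i ≡ -i` modulo 3, the sum `1 + i` itself, and `1 - i = -i(1 + i)` for
  -- the generator `i`.
  refine fourLoopsNullhomotopic_and_simplyConnectedSpace_quotient (γ := (⟨1, 1⟩ : GaussianInt))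
    ?_ ?_ ⟨-gaussianI, ?_⟩ ⟨1, gaussianI, ?_⟩ closure_gaussianI ?_
  · intro x
    by_cases h0 : (3 : GaussianInt) ∣ x
    · exact Or.inl h0
    refine Or.inr ?_
    simp only [three_dvd_gaussian_iff] at h0 ⊢
    suffices h : ∃ ε ∈ ({1, -1, gaussianI, -gaussianI} : Set GaussianIntˣ),
        ((3 : ℤ) ∣ (x - ε).re ∧ (3 : ℤ) ∣ (x - ε).im) ∨
        ((3 : ℤ) ∣ (x - ⟨1, 1⟩ * ε).re ∧ (3 : ℤ) ∣ (x - ⟨1, 1⟩ * ε).im) from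
      h.imp fun _ h => h.2
    simp [gaussianI]
    omega
  · intro ε
    rw [three_dvd_gaussian_iff, Zsqrtd.re_sub, Zsqrtd.im_sub]
    have := gaussian_unit_cases ε
    dsimp only
    omega
  · rw [three_dvd_gaussian_iff]
    simp [gaussianI]
  · rw [three_dvd_gaussian_iff]
    simp [gaussianI]
  · rintro _ rfl
    refine ⟨-gaussianI, ?_⟩
    rw [three_dvd_gaussian_iff]
    simp [gaussianI]

/-! ### Eisenstein integers modulo a prime of norm thirteen -/

open scoped QuadraticAlgebra

/-- The primitive cube root of unity as a unit of the Eisenstein integers. -/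
def omegaUnit : EisensteinIntˣ :=
  ⟨⟨0, 1⟩, ⟨-1, -1⟩, by ext <;> simp, by ext <;> simp⟩

theorem eisenstein_unit_cases (ε : EisensteinIntˣ) :
    ((ε : EisensteinInt).re = 1 ∧ (ε : EisensteinInt).im = 0) ∨
    ((ε : EisensteinInt).re = -1 ∧ (ε : EisensteinInt).im = 0) ∨
    ((ε : EisensteinInt).re = 0 ∧ (ε : EisensteinInt).im = 1) ∨
    ((ε : EisensteinInt).re = 0 ∧ (ε : EisensteinInt).im = -1) ∨
    ((ε : EisensteinInt).re = -1 ∧ (ε : EisensteinInt).im = -1) ∨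
    ((ε : EisensteinInt).re = 1 ∧ (ε : EisensteinInt).im = 1) := by
  have h1 := congrArg QuadraticAlgebra.re ε.mul_inv
  have h2 := congrArg QuadraticAlgebra.im ε.mul_inv
  rw [QuadraticAlgebra.re_mul, QuadraticAlgebra.re_one] at h1
  rw [QuadraticAlgebra.im_mul, QuadraticAlgebra.im_one] at h2
  generalize (ε : EisensteinInt).re = a at *
  generalize (ε : EisensteinInt).im = b at *
  generalize ((ε⁻¹ : EisensteinIntˣ) : EisensteinInt).re = c at *
  generalize ((ε⁻¹ : EisensteinIntˣ) : EisensteinInt).im = d at *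
  -- Multiplicativity of the norm form. It is nonnegative, so it equals 1 on units, and `4(a² - ab +
  -- b²) = (2b - a)² + 3a²` bounds the coordinates.
  have h : (a * a - a * b + b * b) * (c * c - c * d + d * d) = 1 := by
    have : (a * a - a * b + b * b) * (c * c - c * d + d * d) =
        (a * c + -1 * b * d) * (a * c + -1 * b * d) -
        (a * c + -1 * b * d) * (a * d + b * c + -1 * b * d) +
        (a * d + b * c + -1 * b * d) * (a * d + b * c + -1 * b * d) := by ring
    rw [this, h1, h2]
    norm_num
  have hn : a * a - a * b + b * b = 1 := by
    rcases Int.eq_one_or_neg_one_of_mul_eq_one h with h | h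
    · exact h
    · nlinarith [sq_nonneg (a - b), sq_nonneg a, sq_nonneg b]
  have ha1 : a ≤ 1 := by nlinarith [sq_nonneg (2 * b - a)]
  have ha2 : -1 ≤ a := by nlinarith [sq_nonneg (2 * b - a)]
  have hb1 : b ≤ 1 := by nlinarith [sq_nonneg (2 * a - b)]
  have hb2 : -1 ≤ b := by nlinarith [sq_nonneg (2 * a - b)]
  interval_cases a <;> interval_cases b <;> simp at hn ⊢

theorem closure_neg_one_omegaUnit : Subgroup.closure {-1, omegaUnit} = ⊤ := by
  refine eq_top_iff.2 fun ε _ => ?_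
  have hn : -1 ∈ Subgroup.closure {-1, omegaUnit} := Subgroup.subset_closure (by simp)
  have hw : omegaUnit ∈ Subgroup.closure {-1, omegaUnit} := Subgroup.subset_closure (by simp)
  rcases eisenstein_unit_cases ε with h | h | h | h | h | h
  · obtain rfl : ε = 1 := Units.ext (QuadraticAlgebra.ext h.1 h.2)
    exact Subgroup.one_mem _
  · obtain rfl : ε = -1 := Units.ext (QuadraticAlgebra.ext h.1 h.2)
    exact hn
  · obtain rfl : ε = omegaUnit := Units.ext (QuadraticAlgebra.ext h.1 h.2)
    exact hw
  · obtain rfl : ε = -1 * omegaUnit :=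
      Units.ext (QuadraticAlgebra.ext (by simp [omegaUnit, h.1]) (by simp [omegaUnit, h.2]))
    exact Subgroup.mul_mem _ hn hw
  · obtain rfl : ε = omegaUnit⁻¹ := Units.ext (QuadraticAlgebra.ext h.1 h.2)
    exact Subgroup.inv_mem _ hw
  · obtain rfl : ε = -1 * omegaUnit⁻¹ :=
      Units.ext (QuadraticAlgebra.ext (by simp [omegaUnit, h.1]) (by simp [omegaUnit, h.2]))
    exact Subgroup.mul_mem _ hn (Subgroup.inv_mem _ hw)

/-- The hypothesis identifies the quotient with the field of 13 elements, `ω` going to `t`, one of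
the primitive cube roots 3 and 9. The image of the units is the group of squares and 2 is a
non-square, equal to `1 + 1`. Both `1 - (-1) = 2` and `1 - t` are non-squares. The single generator
`-ω` would not do, since `1 + ω = -ω²` is a unit. -/
theorem eisenstein_thirteen {p : EisensteinInt} {t : ℤ} (ht : t = 3 ∨ t = 9)
    (hp : ∀ z : EisensteinInt, p ∣ z ↔ (13 : ℤ) ∣ z.re + t * z.im) :
    FourLoopsNullhomotopic (BDA (unitImage p) 2) ∧
      SimplyConnectedSpace (Realization (BDA (unitImage p) 2)) := by
  have hs : ∀ P : EisensteinIntˣ → Prop,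
      (∃ ε ∈ ({1, -1, omegaUnit, -omegaUnit, omegaUnit⁻¹, -omegaUnit⁻¹} : Set EisensteinIntˣ),
        P ε) → ∃ ε, P ε := fun P h => h.imp fun _ h => h.2
  have hinv : ((omegaUnit⁻¹ : EisensteinIntˣ) : EisensteinInt) = ⟨-1, -1⟩ := rfl
  have hom : (omegaUnit : EisensteinInt) = ⟨0, 1⟩ := rfl
  refine fourLoopsNullhomotopic_and_simplyConnectedSpace_quotient (γ := (⟨2, 0⟩ : EisensteinInt))
    ?_ ?_ (hs _ ?_) ⟨1, 1, ?_⟩ closure_neg_one_omegaUnit ?_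
  · intro x
    by_cases h0 : p ∣ x
    · exact Or.inl h0
    refine Or.inr (hs _ ?_)
    simp only [hp] at h0 ⊢
    simp [hom, hinv]
    rcases ht with rfl | rfl <;> omega
  · intro ε
    rw [hp, QuadraticAlgebra.re_sub, QuadraticAlgebra.im_sub]
    have := eisenstein_unit_cases ε
    dsimp only
    rcases ht with rfl | rfl <;> omega
  · simp only [hp]
    simp [hom, hinv]
    rcases ht with rfl | rfl <;> omega
  · rw [hp]
    simp
  · intro g hg
    refine hs _ ?_
    simp only [hp]
    rcases hg with rfl | rfl
    · simp [hom, hinv]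
    · simp [hom, hinv]
      rcases ht with rfl | rfl <;> omega

theorem four_omega_add_one_dvd_iff (z : EisensteinInt) :
    4 * eisensteinOmega + 1 ∣ z ↔ (13 : ℤ) ∣ z.re + 3 * z.im := by
  constructor
  · rintro ⟨w, rfl⟩
    refine ⟨w.re - w.im, ?_⟩
    simp [eisensteinOmega]
    ring
  · rintro ⟨k, hk⟩
    -- Here `z = 13k + im(ω - 3)`, with `13 = (4ω + 1)(-3 - 4ω)` and `ω - 3 = (4ω + 1)(1 + ω)`.
    refine ⟨⟨-3 * k + z.im, -4 * k + z.im⟩, ?_⟩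
    ext
    · simp [eisensteinOmega]
      linarith
    · simp [eisensteinOmega]
      linarith

theorem four_omega_add_three_dvd_iff (z : EisensteinInt) :
    4 * eisensteinOmega + 3 ∣ z ↔ (13 : ℤ) ∣ z.re + 9 * z.im := by
  constructor
  · rintro ⟨w, rfl⟩
    refine ⟨3 * w.re - w.im, ?_⟩
    simp [eisensteinOmega]
    ring
  · rintro ⟨k, hk⟩
    -- Here `z = 13k + im(ω - 9)`, with `13 = (4ω + 3)(-1 - 4ω)` and `ω - 9 = (4ω + 3)(1 + 3ω)`.
    refine ⟨⟨-k + z.im, -4 * k + 3 * z.im⟩, ?_⟩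
    ext
    · simp [eisensteinOmega]
      linarith
    · simp [eisensteinOmega]
      linarith

end BDAComplex

end

theorem lemma2p25 :
    (∀ (F : Type*) [Field F] (U : Subgroup Fˣ),
      (U = ⊤ ∨ U.index = 2) →
      (∀ c : Fˣ, c ∉ U → ∃ u₁ ∈ U, ∃ u₂ ∈ U, (c : F) = u₁ + u₂) →
      (∀ c : Fˣ, c ∉ U → ∃ u ∈ U, ∃ d : Fˣ, d ∉ U ∧ (c : F) + u = d) →
      (SimplyConnectedSpace (BDAComplex.Realization (BDAComplex.BDA U 2)) ↔
        BDAComplex.FourLoopsNullhomotopic (BDAComplex.BDA U 2))) ∧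
    (BDAComplex.FourLoopsNullhomotopic
        (BDAComplex.BDA (BDAComplex.unitImage (3 : GaussianInt)) 2) ∧
      SimplyConnectedSpace (BDAComplex.Realization
        (BDAComplex.BDA (BDAComplex.unitImage (3 : GaussianInt)) 2))) ∧
    (BDAComplex.FourLoopsNullhomotopic
        (BDAComplex.BDA (BDAComplex.unitImage (4 * BDAComplex.eisensteinOmega + 1)) 2) ∧
      SimplyConnectedSpace (BDAComplex.Realization
        (BDAComplex.BDA (BDAComplex.unitImage (4 * BDAComplex.eisensteinOmega + 1)) 2))) ∧
    (BDAComplex.FourLoopsNullhomotopic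
        (BDAComplex.BDA (BDAComplex.unitImage (4 * BDAComplex.eisensteinOmega + 3)) 2) ∧
      SimplyConnectedSpace (BDAComplex.Realization
        (BDAComplex.BDA (BDAComplex.unitImage (4 * BDAComplex.eisensteinOmega + 3)) 2))) := by
  refine ⟨fun F _ U hU hsum _ => ⟨BDAComplex.fourLoopsNullhomotopic_of_simplyConnectedSpace,
    BDAComplex.simplyConnectedSpace_BDA_of_fourLoopsNullhomotopic (fun a b ha hb => ?_) hsum⟩,
    BDAComplex.gaussian_three,
    BDAComplex.eisenstein_thirteen (Or.inl rfl) BDAComplex.four_omega_add_one_dvd_iff,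
    BDAComplex.eisenstein_thirteen (Or.inr rfl) BDAComplex.four_omega_add_three_dvd_iff⟩
  rcases hU with rfl | hU
  · exact Subgroup.mem_top _
  · exact (Subgroup.mul_mem_iff_of_index_two hU).2 (iff_of_false ha hb)
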